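/- Let $\mathcal{D} \subset \mathbb{Z}_{\ge 0}$ be a (finite or infinite) set with at least two elements. Put $r = \min \mathcal{D}$, $p = \gcd\{d_1 - d_2 \mid d_1, d_2 \in \mathcal{D}\}$, and let $\max\mathcal{D} = +\infty$ if $\mathcal{D}$ is infinite. Let $\operatorname{Set}_{\mathcal{D}}(x) = \sum_{d \in \mathcal{D}} \frac{x^d}{d!}$, let $\mathcal{D}-1 = \{d - 1 \mid d \in \mathcal{D},\ d \ge 1\}$, and let $\phi(x) = \frac{x \operatorname{Set}_{\mathcal{D}-1}(x)}{\operatorname{Set}_{\mathcal{D}}(x)}$. A multigraph with $n$ vertices and $m$ edges has vertex set $\{1, \ldots, n\}$ and a multiset of $m$ edges, each an unordered pair of not necessarily distinct vertices; the degree of a vertex is its number of occurrences in the edges (a loop counts twice). The compensation factor of such a multigraph $G$ is $\kappa(G) = \frac{\mathsf{orderings}(G)}{2^m m!}$, where $\mathsf{orderings}(G)$ is the number of sequences of $m$ ordered pairs of vertices that can be obtained by ordering the edges of $G$ and the two vertices of each edge. Let $\operatorname{MG}^{(\mathcal{D})}_{n,m}$ be the set of multigraphs with $n$ vertices and $m$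 edges in which every vertex has its degree in $\mathcal{D}$. Let $[a,b]$ be a fixed compact interval contained in the open interval $]r, \max\mathcal{D}[$. Then for all integers $m \ge 0$, $n \ge 1$ with $\frac{2m}{n} \in [a,b]$, the equation $\phi(\zeta) = \frac{2m}{n}$ has a unique positive solution $\zeta$. As $m, n$ tend to infinity with $\frac{2m}{n} \in [a,b]$ and $p \mid 2m - rn$, $\phi$ is differentiable at $\zeta$ with $\phi'(\zeta) > 0$, and \[ \sum_{G \in \operatorname{MG}^{(\mathcal{D})}_{n,m}} \kappa(G) = \frac{(2m)!}{2^m m!}\, \frac{p}{\sqrt{2 \pi n \zeta \phi'(\zeta)}}\, \frac{\operatorname{Set}_{\mathcal{D}}(\zeta)^n}{\zeta^{2m}} \left(1 + O(n^{-1})\right), \] where the constant in the $O$ depends only on $\mathcal{D}$, $a$ and $b$. -/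

import Mathlib

/-- The generating function `Set_D(x) = ∑_{d ∈ D} x^d / d!` of a set `D` of natural numbers. -/
noncomputable def setGF (D : Set ℕ) (x : ℝ) : ℝ :=
  ∑' d : D, x ^ (d : ℕ) / (Nat.factorial (d : ℕ) : ℝ)

/-- The series defining `setGF` converges for every set `D` and every real `x`. -/
theorem setGF_summable (D : Set ℕ) (x : ℝ) :
    Summable (fun d : D => x ^ (d : ℕ) / (Nat.factorial (d : ℕ) : ℝ)) :=
  (Real.summable_pow_div_factorial x).subtype D

/-- The shifted set `D - i = {d - i ≥ 0 | d ∈ D}`. -/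
def shiftSet (D : Set ℕ) (i : ℕ) : Set ℕ := {e | e + i ∈ D}

/-- The valuation `r = min D`. -/
noncomputable def valuationOf (D : Set ℕ) : ℕ := sInf D

/-- The supremum of `D` in the extended reals: `max D` if `D` is finite and nonempty,
`+∞` if `D` is infinite. -/
noncomputable def maxOf (D : Set ℕ) : EReal := ⨆ d ∈ D, ((d : ℝ) : EReal)

/-- The periodicity `p = gcd {d₁ - d₂ | d₁, d₂ ∈ D}`: the greatest of the common divisors of all
differences. It is only used for sets with at least two elements, for which the common divisors
are bounded. -/
noncomputable def periodicity (D : Set ℕ) : ℕ :=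
  sSup {k : ℕ | ∀ d₁ ∈ D, ∀ d₂ ∈ D, (k : ℤ) ∣ (d₁ : ℤ) - (d₂ : ℤ)}

/-- The function `φ(x) = x Set_{D-1}(x) / Set_D(x)`. -/
noncomputable def phi (D : Set ℕ) (x : ℝ) : ℝ :=
  x * setGF (shiftSet D 1) x / setGF D x

/-- Multigraphs with `n` labelled vertices and `m` edges: multisets of `m` unordered pairs of
not necessarily distinct vertices. -/
abbrev Multigraph (n m : ℕ) : Type := Sym (Sym2 (Fin n)) m

/-- The degree of a vertex: its number of occurrences in the edges (a loop counts twice). -/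
def Multigraph.degree {n m : ℕ} (G : Multigraph n m) (v : Fin n) : ℕ :=
  ((G : Multiset (Sym2 (Fin n))).map (fun e => e.toMultiset.count v)).sum

/-- The multigraph obtained by forgetting the order of the edges in a sequence of `m` ordered
pairs of vertices, and the order of the vertices in each pair. -/
def Multigraph.ofSequence {n m : ℕ} (f : Fin m → Fin n × Fin n) : Multigraph n m :=
  ⟨Finset.univ.val.map (fun i => s((f i).1, (f i).2)), by simp⟩

/-- The number of orderings of `G`: sequences of ordered pairs of vertices obtained by ordering the
edges of `G` and the vertices in each edge. -/
def Multigraph.orderings {n m : ℕ} (G : Multigraph n m) : ℕ :=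
  (Finset.univ.filter (fun f : Fin m → Fin n × Fin n => Multigraph.ofSequence f = G)).card

/-- The compensation factor `κ(G) = orderings(G) / (2^m m!)`. -/
noncomputable def Multigraph.kappa {n m : ℕ} (G : Multigraph n m) : ℝ :=
  (G.orderings : ℝ) / (2 ^ m * (Nat.factorial m : ℝ))

open Classical in
/-- The set of multigraphs with `n` vertices and `m` edges in which every degree lies in `D`. -/
noncomputable def multigraphsWithDegrees (D : Set ℕ) (n m : ℕ) : Finset (Multigraph n m) :=
  Finset.univ.filter (fun G => ∀ v : Fin n, G.degree v ∈ D)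

/-- The total weight of the multigraphs with `n` vertices, `m` edges and all degrees in `D`. -/
noncomputable def totalWeight (D : Set ℕ) (n m : ℕ) : ℝ :=
  ∑ G ∈ multigraphsWithDegrees D n m, G.kappa

/-!
The weight of a multigraph counts the ways to write it as a sequence of ordered pairs, so
`totalWeight D n m` is, up to the factor `2 ^ m * m!`, the number of maps from the `2 m` edge ends
to the `n` vertices whose fibre sizes lie in `D`. By the multinomial theorem this number is
`(2 m)!` times the coefficient of `x ^ (2 m)` in `Set_D(x) ^ n` (`totalWeight_eq_coeff`).

For `ζ > 0`, give `d ∈ D` the mass `ζ ^ d / (d! Set_D(ζ))`. This Boltzmann distribution has mean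
`φ(ζ)` and variance `ζ φ'(ζ)` (`hasSum_boltzmann_mul`, `hasSum_boltzmann_variance`). The variance
is positive as `D` has two elements, so `φ` increases strictly; its values come arbitrarily close
to `r` near `0` and exceed each number below `max D` near `∞`, whence `φ(ζ) = 2 m / n` has exactly
one solution (`existsUnique_phi_eq`), which stays in a compact subinterval of `]0, ∞[`.

The coefficient divided by `Set_D(ζ) ^ n / ζ ^ (2 m)` is the probability that `n` independent
Boltzmann variables sum to `2 m`, their mean. By Fourier inversion (`integral_charSum_pow`) it is
`p / (2 π)` times the integral over `|t| ≤ π / p` of `g(t) ^ n`, where `g` is the centred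
characteristic function. Two facts about `g`, uniform in `ζ`, give the asymptotics by Laplace's
method (`norm_integral_pow_sub_gaussian_le`). One is the bound `|g(t)| ≤ exp (-c t ^ 2)` on the whole
interval: two atoms `d₁, d₂` yield `|g(t)| ≤ 1 - 2 w d₁ w d₂ sin² ((d₁ - d₂) t / 2)`, and since `p` is
an integer combination of differences, these sines control `sin (p t / 2)`
(`exists_norm_charSum_le_exp`). The other is the third order Taylor expansion of `g` at `0`
(`norm_charSum_sub_taylor_le`). The cubic term contributes an odd function, whose integral vanishes,
and therefore the relative error is `O(1 / n)` and not only `O(1 / √n)`.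
-/

/-! ### Multigraphs as maps with prescribed fibre sizes -/

open Finset in
/-- The number of maps with prescribed fibre sizes is a multinomial coefficient. -/
theorem card_filter_card_fiber_eq_multinomial {α β : Type*} [Fintype α] [DecidableEq α]
    [Fintype β] [DecidableEq β] (l : β → ℕ) (hl : ∑ v, l v = Fintype.card α) :
    #{g : α → β | ∀ v, #{i | g i = v} = l v} = Nat.multinomial univ l := by
  -- Both sides are the coefficient of `X ^ l` in `(∑ v, X v) ^ card α`.
  have key : ∀ k : β → ℕ, (∏ v, (MvPolynomial.X v : MvPolynomial β ℕ) ^ k v)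
      = MvPolynomial.monomial (Finsupp.equivFunOnFinite.symm k) 1 := by
    intro k
    rw [MvPolynomial.monomial_eq]
    simp [Finsupp.prod_fintype]
  have h1 : (∑ v : β, (MvPolynomial.X v : MvPolynomial β ℕ)) ^ Fintype.card α
      = ∑ g : α → β, MvPolynomial.monomial
          (Finsupp.equivFunOnFinite.symm fun v => #{i | g i = v}) 1 := by
    rw [← Finset.card_univ, ← Finset.prod_const, Finset.prod_univ_sum, Fintype.piFinset_univ]
    refine Finset.sum_congr rfl fun g _ => ?_
    rw [← key, ← Finset.prod_fiberwise' univ g]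
    simp
  have h2 := Finset.sum_pow_eq_sum_piAntidiag (univ : Finset β)
    (fun v => (MvPolynomial.X v : MvPolynomial β ℕ)) (Fintype.card α)
  rw [h1] at h2
  have h3 := congrArg (MvPolynomial.coeff (Finsupp.equivFunOnFinite.symm l)) h2
  simp only [MvPolynomial.coeff_sum, MvPolynomial.coeff_monomial, key,
    EmbeddingLike.apply_eq_iff_eq] at h3
  have h4 : ∀ k : β → ℕ, MvPolynomial.coeff (Finsupp.equivFunOnFinite.symm l)
      ((Nat.multinomial univ k : MvPolynomial β ℕ) *
        MvPolynomial.monomial (Finsupp.equivFunOnFinite.symm k) 1)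
      = if k = l then Nat.multinomial univ k else 0 := by
    intro k
    rw [← map_natCast (MvPolynomial.C : ℕ →+* MvPolynomial β ℕ), MvPolynomial.coeff_C_mul,
      MvPolynomial.coeff_monomial]
    simp
  simp only [h4] at h3
  rw [Finset.sum_ite_eq_of_mem' _ _ _ (by simp [hl])] at h3
  rw [← h3, Finset.card_filter]
  refine Finset.sum_congr rfl fun g _ => ?_
  simp [funext_iff]

open Classical in
/-- The coefficients of `Set_D` as a power series: `1 / d!` for `d ∈ D`, and `0` otherwise. -/
noncomputable def egfCoeff (D : Set ℕ) (d : ℕ) : ℝ := if d ∈ D then 1 / (Nat.factorial d : ℝ) else 0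

open Finset Classical in
/-- The power series `Set_D ^ n` is the exponential generating function of the maps to an
`n`-element set all of whose fibres have their size in `D`. -/
theorem card_filter_card_fiber_mem {α : Type*} [Fintype α] (D : Set ℕ) (n : ℕ) :
    (#{g : α → Fin n | ∀ v, #{i | g i = v} ∈ D} : ℝ)
      = (Fintype.card α).factorial
          * PowerSeries.coeff (Fintype.card α) (PowerSeries.mk (egfCoeff D) ^ n) := by
  have hpow : PowerSeries.mk (egfCoeff D) ^ n = ∏ _v : Fin n, PowerSeries.mk (egfCoeff D) := by
    simp
  rw [hpow, PowerSeries.coeff_prod, Finset.mul_sum]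
  have hmaps : ∀ g ∈ ({g : α → Fin n | ∀ v, #{i | g i = v} ∈ D} : Finset _),
      (Finsupp.equivFunOnFinite.symm fun v => #{i | g i = v})
        ∈ finsuppAntidiag (univ : Finset (Fin n)) (Fintype.card α) := by
    intro g _
    simp only [mem_finsuppAntidiag, subset_univ, and_true, Finsupp.equivFunOnFinite_symm_apply_apply]
    simpa using (Finset.card_eq_sum_card_fiberwise (s := (univ : Finset α))
      (t := (univ : Finset (Fin n))) (f := g) (by simp)).symm
  rw [Finset.card_eq_sum_card_fiberwise hmaps, Nat.cast_sum]
  refine Finset.sum_congr rfl fun l hl => ?_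
  have hl' : ∑ v, l v = Fintype.card α := by simpa using hl
  by_cases hD : ∀ v, l v ∈ D
  · have : ({g ∈ ({g : α → Fin n | ∀ v, #{i | g i = v} ∈ D} : Finset _) |
        (Finsupp.equivFunOnFinite.symm fun v => #{i | g i = v}) = l})
        = ({g : α → Fin n | ∀ v, #{i | g i = v} = l v} : Finset _) := by
      ext g
      simp only [mem_filter, mem_univ, true_and, Finsupp.ext_iff,
        Finsupp.equivFunOnFinite_symm_apply_apply]
      exact ⟨fun h => h.2, fun h => ⟨fun v => (h v).symm ▸ hD v, h⟩⟩
    have hcount : #({g : α → Fin n | ∀ v, #{i | g i = v} = l v} : Finset _)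
        = Nat.multinomial univ l := by
      convert card_filter_card_fiber_eq_multinomial _ hl'
    rw [this, hcount]
    have hs := Nat.multinomial_spec (univ : Finset (Fin n)) l
    rw [hl'] at hs
    rw [← hs]
    simp only [PowerSeries.coeff_mk, egfCoeff, hD, if_true, Nat.cast_mul, Nat.cast_prod]
    rw [mul_right_comm, ← Finset.prod_mul_distrib]
    rw [Finset.prod_eq_one, one_mul]
    intro v _
    field_simp
  · push Not at hD
    obtain ⟨v, hv⟩ := hD
    rw [Finset.prod_eq_zero (mem_univ v) (by simp [egfCoeff, hv]), mul_zero]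
    norm_cast
    rw [Finset.card_eq_zero, Finset.filter_eq_empty_iff]
    rintro g hg rfl
    simp only [mem_filter, mem_univ, true_and] at hg
    exact hv (by simpa using hg v)

open Finset in
theorem Multigraph.degree_ofSequence {n m : ℕ} (f : Fin m → Fin n × Fin n) (v : Fin n) :
    (Multigraph.ofSequence f).degree v
      = #{i : Fin m ⊕ Fin m | Sum.elim (fun i => (f i).1) (fun i => (f i).2) i = v} := by
  have h : ∀ a b : Fin n, Multiset.count v (s(a, b) : Sym2 (Fin n)).toMultiset
      = (if a = v then 1 else 0) + (if b = v then 1 else 0) := by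
    intro a b
    rw [show (s(a, b) : Sym2 (Fin n)).toMultiset = {a, b} from rfl]
    simp only [Multiset.insert_eq_cons, Multiset.count_cons, Multiset.count_singleton]
    rw [add_comm]
    simp [eq_comm]
  simp only [Multigraph.degree, Multigraph.ofSequence, Sym.coe_mk, Multiset.map_map]
  rw [Finset.card_filter, Fintype.sum_sum_type, ← Finset.sum_add_distrib]
  exact Finset.sum_congr rfl fun i _ => h _ _

open Finset in
/-- The total weight counts, up to the factor `2 ^ m * m!`, the maps from the `2 m` edge ends to
the vertices whose fibre sizes, the degrees, lie in `D`. -/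
theorem totalWeight_eq_coeff (D : Set ℕ) (n m : ℕ) :
    totalWeight D n m = ((2 * m).factorial : ℝ) / (2 ^ m * (m.factorial : ℝ))
      * PowerSeries.coeff (2 * m) (PowerSeries.mk (egfCoeff D) ^ n) := by
  classical
  have hcard : Fintype.card (Fin m ⊕ Fin m) = 2 * m := by simp [two_mul]
  have h := card_filter_card_fiber_mem (α := Fin m ⊕ Fin m) D n
  rw [hcard] at h
  rw [div_mul_eq_mul_div, ← h, totalWeight]
  simp only [Multigraph.kappa]
  rw [← Finset.sum_div]
  congr 1
  simp only [Multigraph.orderings]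
  rw [← Nat.cast_sum]
  norm_cast
  have h1 : (∑ G ∈ multigraphsWithDegrees D n m,
        #{f : Fin m → Fin n × Fin n | Multigraph.ofSequence f = G})
      = #{f : Fin m → Fin n × Fin n | ∀ v, (Multigraph.ofSequence f).degree v ∈ D} := by
    rw [Finset.card_eq_sum_card_fiberwise (f := Multigraph.ofSequence)
      (t := multigraphsWithDegrees D n m)]
    · refine Finset.sum_congr rfl fun G hG => ?_
      congr 1
      ext f
      simp only [mem_filter, mem_univ, true_and]
      constructor
      · rintro rfl
        simpa [multigraphsWithDegrees] using hG
      · exact fun h => h.2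
    · intro f hf
      simpa [multigraphsWithDegrees] using hf
  rw [h1]
  refine Finset.card_equiv
    ((Equiv.arrowProdEquivProdArrow _ _ _).trans (Equiv.sumArrowEquivProdArrow _ _ _).symm) ?_
  intro f
  simp only [mem_filter, mem_univ, true_and, Multigraph.degree_ofSequence]
  rfl

/-! ### Powers of power series and Fourier inversion -/

/-- Absolutely convergent evaluation of power series commutes with taking powers. -/
theorem summable_and_tsum_coeff_pow (f : ℕ → ℝ) (z : ℂ) (h : Summable fun k => ‖(f k : ℂ) * z ^ k‖)
    (n : ℕ) :
    Summable (fun k => ‖((PowerSeries.coeff k (PowerSeries.mk f ^ n) : ℝ) : ℂ) * z ^ k‖) ∧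
      ∑' k, ((PowerSeries.coeff k (PowerSeries.mk f ^ n) : ℝ) : ℂ) * z ^ k
        = (∑' k, (f k : ℂ) * z ^ k) ^ n := by
  induction n with
  | zero =>
    have h0 : ∀ k, k ≠ 0 →
        ((PowerSeries.coeff k (PowerSeries.mk f ^ 0) : ℝ) : ℂ) * z ^ k = 0 := by
      intro k hk
      simp [PowerSeries.coeff_one, hk]
    refine ⟨summable_of_ne_finset_zero (s := {0}) fun k hk => ?_, ?_⟩
    · rw [h0 k (by simpa using hk), norm_zero]
    · rw [tsum_eq_single 0 h0]
      simp
  | succ n ih =>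
    have hc : ∀ k, ((PowerSeries.coeff k (PowerSeries.mk f ^ (n + 1)) : ℝ) : ℂ) * z ^ k
        = ∑ ij ∈ Finset.HasAntidiagonal.antidiagonal k,
          (((PowerSeries.coeff ij.1 (PowerSeries.mk f ^ n) : ℝ) : ℂ) * z ^ ij.1)
            * ((f ij.2 : ℂ) * z ^ ij.2) := by
      intro k
      rw [pow_succ, PowerSeries.coeff_mul, Complex.ofReal_sum, Finset.sum_mul]
      refine Finset.sum_congr rfl fun ij hij => ?_
      rw [← Finset.HasAntidiagonal.mem_antidiagonal.1 hij, PowerSeries.coeff_mk, pow_add]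
      push_cast
      ring
    have hsum := summable_norm_sum_mul_antidiagonal_of_summable_norm ih.1 h
    have hmul := tsum_mul_tsum_eq_tsum_sum_antidiagonal_of_summable_norm ih.1 h
    refine ⟨hsum.congr fun k => by rw [hc k], ?_⟩
    rw [tsum_congr hc, ← hmul, ih.2, pow_succ]

/-- If the exponents of `f` are congruent to `r` modulo `p`, those of `f ^ n` are congruent to
`r n`. -/
theorem dvd_sub_of_coeff_pow_ne_zero {f : ℕ → ℝ} {p r : ℤ}
    (hf : ∀ d, f d ≠ 0 → p ∣ (d : ℤ) - r) (n k : ℕ)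
    (hk : PowerSeries.coeff k (PowerSeries.mk f ^ n) ≠ 0) : p ∣ (k : ℤ) - r * n := by
  induction n generalizing k with
  | zero =>
    have : k = 0 := by
      by_contra h
      simp [PowerSeries.coeff_one, h] at hk
    simp [this]
  | succ n ih =>
    rw [pow_succ, PowerSeries.coeff_mul] at hk
    obtain ⟨⟨i, j⟩, hij, hne⟩ := Finset.exists_ne_zero_of_sum_ne_zero hk
    rw [← Finset.HasAntidiagonal.mem_antidiagonal.1 hij]
    have h1 := ih i (left_ne_zero_of_mul hne)
    have h2 := hf j (by simpa using right_ne_zero_of_mul hne)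
    have h3 : ((i + j : ℕ) : ℤ) - r * ((n + 1 : ℕ) : ℤ) = (i - r * n) + (j - r) := by
      push_cast
      ring
    rw [h3]
    exact dvd_add h1 h2

open Complex in
theorem integral_exp_period {p : ℕ} (hp : 0 < p) (l : ℤ) :
    ∫ t in (-(Real.pi / p))..(Real.pi / p), cexp (I * ((p * l : ℤ) : ℂ) * t)
      = if l = 0 then ((2 * Real.pi / p : ℝ) : ℂ) else 0 := by
  split_ifs with hl
  · subst hl
    simp
    ring
  · have hp' : (p : ℂ) ≠ 0 := by exact_mod_cast hp.ne'
    have hl' : (l : ℂ) ≠ 0 := by exact_mod_cast hl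
    rw [integral_exp_mul_complex (by push_cast; simp [hp', hl'])]
    rw [div_eq_zero_iff]
    left
    rw [sub_eq_zero, Complex.exp_eq_exp_iff_exists_int]
    refine ⟨l, ?_⟩
    push_cast
    field_simp
    ring

open Complex in
/-- Cauchy's coefficient formula on the unit circle for an absolutely convergent power series
whose exponents lie in one residue class modulo `p`: an arc of length `2 π / p` suffices. -/
theorem integral_charSum_pow {w : ℕ → ℝ} (hw : ∀ d, 0 ≤ w d) (hs : Summable w) {p : ℕ} (hp : 0 < p)
    {r : ℤ} (hsupp : ∀ d, w d ≠ 0 → (p : ℤ) ∣ (d : ℤ) - r) (n N : ℕ)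
    (hN : (p : ℤ) ∣ (N : ℤ) - r * n) :
    ∫ t in (-(Real.pi / p))..(Real.pi / p),
        (∑' d, (w d : ℂ) * cexp (I * t) ^ d) ^ n * cexp (-(I * N * t))
      = ((2 * Real.pi / p * PowerSeries.coeff N (PowerSeries.mk w ^ n) : ℝ) : ℂ) := by
  have hnorm : ∀ t : ℝ, ‖cexp (I * t)‖ = 1 := fun t => norm_exp_I_mul_ofReal t
  have hsum : ∀ t : ℝ, Summable fun k => ‖(w k : ℂ) * cexp (I * t) ^ k‖ := by
    intro t
    simpa [hnorm, abs_of_nonneg (hw _)] using hs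
  have hsn : Summable fun k => ‖((PowerSeries.coeff k (PowerSeries.mk w ^ n) : ℝ) : ℂ)‖ := by
    simpa [hnorm] using (summable_and_tsum_coeff_pow w _ (hsum 0) n).1
  set q : ℕ → ℝ := fun k => PowerSeries.coeff k (PowerSeries.mk w ^ n) with hq
  have hterm := intervalIntegral.hasSum_integral_of_dominated_convergence
    (μ := MeasureTheory.volume) (a := -(Real.pi / p)) (b := Real.pi / p)
    (F := fun k (t : ℝ) => (q k : ℂ) * cexp (I * t) ^ k * cexp (-(I * N * t)))
    (f := fun t : ℝ => (∑' d, (w d : ℂ) * cexp (I * t) ^ d) ^ n * cexp (-(I * N * t)))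
    (fun k _ => ‖(q k : ℂ)‖)
    (fun k => (by fun_prop : Continuous fun t : ℝ =>
      (q k : ℂ) * cexp (I * t) ^ k * cexp (-(I * N * t))).aestronglyMeasurable)
    (fun k => Filter.Eventually.of_forall fun t _ => by
      have : ‖cexp (-(I * N * t))‖ = 1 := by
        rw [show -(I * N * t) = I * ((-(N * t) : ℝ) : ℂ) by push_cast; ring]
        exact hnorm _
      simp [hnorm, this])
    (Filter.Eventually.of_forall fun t _ => hsn)
    (by simp)
    (Filter.Eventually.of_forall fun t _ => by
      obtain ⟨h1, h2⟩ := summable_and_tsum_coeff_pow w _ (hsum t) n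
      rw [← h2]
      exact h1.of_norm.hasSum.mul_right _)
  rw [← hterm.tsum_eq]
  have hint : ∀ k, ∫ t in (-(Real.pi / p))..(Real.pi / p),
      (q k : ℂ) * cexp (I * t) ^ k * cexp (-(I * N * t))
      = if k = N then ((2 * Real.pi / p * q N : ℝ) : ℂ) else 0 := by
    intro k
    by_cases hk : q k = 0
    · simp only [hk]
      split_ifs with h
      · rw [← h, hk]
        simp
      · simp
    · have hd := dvd_sub_of_coeff_pow_ne_zero hsupp n k hk
      -- `k` and `N` are both congruent to `r n`, so the frequency `k - N` is a multiple of `p`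
      obtain ⟨l, hl⟩ : (p : ℤ) ∣ (k : ℤ) - N := by
        have := dvd_sub hd hN
        simpa using this
      have hfun : ∀ t : ℝ, (q k : ℂ) * cexp (I * t) ^ k * cexp (-(I * N * t))
          = (q k : ℂ) * cexp (I * ((p * l : ℤ) : ℂ) * t) := by
        intro t
        rw [← hl, mul_assoc, ← Complex.exp_nat_mul, ← Complex.exp_add]
        congr 2
        push_cast
        ring
      simp only [hfun]
      rw [intervalIntegral.integral_const_mul, integral_exp_period hp]
      have : l = 0 ↔ k = N := by
        have hp' : (p : ℤ) ≠ 0 := by exact_mod_cast hp.ne'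
        constructor
        · rintro rfl
          omega
        · rintro rfl
          simpa [hp.ne'] using hl.symm
      simp only [this]
      split_ifs with h
      · rw [h]
        push_cast
        ring
      · simp
  rw [tsum_congr hint, tsum_ite_eq]

/-! ### Laplace's method for powers of a characteristic function -/

/-- Second order Taylor estimate for `a ↦ a ^ (n + 2)` around `b`. -/
theorem norm_pow_sub_pow_sub_le {a b : ℂ} {ρ : ℝ} (ha : ‖a‖ ≤ ρ) (hb : ‖b‖ ≤ ρ) (n : ℕ) :
    ‖a ^ (n + 2) - b ^ (n + 2) - (n + 2) * b ^ (n + 1) * (a - b)‖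
      ≤ ((n : ℝ) + 2) ^ 2 * ρ ^ n * ‖a - b‖ ^ 2 := by
  have hρ : 0 ≤ ρ := (norm_nonneg a).trans ha
  induction n with
  | zero =>
    have : a ^ (0 + 2) - b ^ (0 + 2) - ((0 : ℕ) + 2) * b ^ (0 + 1) * (a - b) = (a - b) ^ 2 := by
      push_cast
      ring
    rw [this, norm_pow]
    norm_num
    nlinarith [sq_nonneg ‖a - b‖]
  | succ n ih =>
    have : a ^ (n + 1 + 2) - b ^ (n + 1 + 2) - ((n + 1 : ℕ) + 2) * b ^ (n + 1 + 1) * (a - b)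
        = a * (a ^ (n + 2) - b ^ (n + 2) - (n + 2) * b ^ (n + 1) * (a - b))
          + (n + 2) * b ^ (n + 1) * (a - b) ^ 2 := by
      push_cast
      ring
    rw [this]
    have h2 : ‖((n : ℂ) + 2) * b ^ (n + 1) * (a - b) ^ 2‖
        ≤ ((n : ℝ) + 2) * ρ ^ (n + 1) * ‖a - b‖ ^ 2 := by
      rw [norm_mul, norm_mul, norm_pow, norm_pow]
      have : ‖(n : ℂ) + 2‖ = (n : ℝ) + 2 := by
        rw [show (n : ℂ) + 2 = ((n + 2 : ℕ) : ℂ) by push_cast; ring, Complex.norm_natCast]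
        push_cast
        ring
      rw [this]
      gcongr
    refine (norm_add_le _ _).trans ?_
    rw [norm_mul]
    calc ‖a‖ * ‖a ^ (n + 2) - b ^ (n + 2) - (n + 2) * b ^ (n + 1) * (a - b)‖
          + ‖((n : ℂ) + 2) * b ^ (n + 1) * (a - b) ^ 2‖
        ≤ ρ * (((n : ℝ) + 2) ^ 2 * ρ ^ n * ‖a - b‖ ^ 2)
          + ((n : ℝ) + 2) * ρ ^ (n + 1) * ‖a - b‖ ^ 2 := by gcongr
      _ = (((n : ℝ) + 2) ^ 2 + (n + 2)) * (ρ ^ (n + 1) * ‖a - b‖ ^ 2) := by ring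
      _ ≤ (((n : ℝ) + 3) ^ 2) * (ρ ^ (n + 1) * ‖a - b‖ ^ 2) := by
          gcongr
          nlinarith [(Nat.cast_nonneg n : (0 : ℝ) ≤ n)]
      _ = _ := by
          push_cast
          ring

/-- A power of `t ^ 2` costs a factor `1 / x` against the Gaussian `exp (-x t ^ 2)`. -/
theorem pow_mul_exp_neg_le {x : ℝ} (hx : 0 < x) (t : ℝ) (k : ℕ) :
    t ^ (2 * k) * Real.exp (-x * t ^ 2)
      ≤ k.factorial * 2 ^ k / x ^ k * Real.exp (-(x / 2) * t ^ 2) := by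
  have h := Real.pow_div_factorial_le_exp (x / 2 * t ^ 2) (by positivity) k
  have hk : (0 : ℝ) < k.factorial := by positivity
  rw [div_le_iff₀ hk] at h
  have e : Real.exp (-(x / 2) * t ^ 2)
      = Real.exp (x / 2 * t ^ 2) * Real.exp (-x * t ^ 2) := by
    rw [← Real.exp_add]
    ring_nf
  rw [e, ← mul_assoc]
  refine mul_le_mul_of_nonneg_right ?_ (Real.exp_nonneg _)
  calc t ^ (2 * k) = 2 ^ k / x ^ k * (x / 2 * t ^ 2) ^ k := by
        rw [mul_pow, div_pow, pow_mul]
        field_simp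
    _ ≤ 2 ^ k / x ^ k * (Real.exp (x / 2 * t ^ 2) * k.factorial) := by gcongr
    _ = _ := by ring

theorem Real.abs_exp_neg_sub_one_sub_le {u : ℝ} (hu : 0 ≤ u) :
    |Real.exp (-u) - (1 - u)| ≤ u ^ 2 / 2 := by
  have h1 := Real.add_one_le_exp (-u)
  have h2 := Real.quadratic_le_exp_of_nonneg hu
  have h3 : Real.exp (-u) * Real.exp u = 1 := by rw [← Real.exp_add]; simp
  have h4 := Real.exp_pos (-u)
  rw [abs_le]
  constructor
  · nlinarith [sq_nonneg u]
  · have h5 : Real.exp (-u) * (1 + u + u ^ 2 / 2) ≤ 1 := by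
      calc _ ≤ Real.exp (-u) * Real.exp u := by gcongr
        _ = 1 := h3
    have h6 : 1 ≤ (1 - u + u ^ 2 / 2) * (1 + u + u ^ 2 / 2) := by nlinarith [sq_nonneg (u ^ 2)]
    have h7 : Real.exp (-u) ≤ 1 - u + u ^ 2 / 2 := by
      by_contra! h
      have : 0 < 1 + u + u ^ 2 / 2 := by positivity
      nlinarith
    linarith

/-- Pointwise comparison of `g ^ N` with the Gaussian `b ^ N`, corrected by the odd part of
`N b ^ (N - 1) (g - b)`. -/
theorem norm_pow_sub_gaussian_pow_le {c M T s m₃ t : ℝ} {γ : ℂ} (hc : 0 < c) (hT : 0 < T)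
    (hM : 0 ≤ M) (hcs : 2 * c ≤ s) (hsM : s ≤ M) (hm : |m₃| ≤ M) (ht : |t| ≤ T)
    (hg1 : ‖γ‖ ≤ Real.exp (-c * t ^ 2))
    (hg2 : ‖γ - (1 - (s * t ^ 2 / 2 : ℝ) - Complex.I * (m₃ * t ^ 3 / 6 : ℝ))‖ ≤ M * t ^ 4)
    {N : ℕ} (hN : 2 ≤ N) :
    ‖γ ^ N - (Real.exp (-(s / 2) * t ^ 2) : ℂ) ^ N + Complex.I
        * ((N * m₃ / 6 * (Real.exp (-(s / 2) * t ^ 2) ^ (N - 1) * t ^ 3) : ℝ) : ℂ)‖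
      ≤ Real.exp (2 * c * T ^ 2)
          * (48 * (M + (M + M ^ 2) * T) ^ 2 / c ^ 3 + 8 * (M + M ^ 2) / c ^ 2) / N
        * Real.exp (-(c * N / 2) * t ^ 2) := by
  set A : ℝ := M + M ^ 2 with hA
  set B : ℝ := M + A * T with hB
  have hA0 : 0 ≤ A := by positivity
  have hB0 : 0 ≤ B := by positivity
  have hs : 0 < s := by linarith
  set b : ℝ := Real.exp (-(s / 2) * t ^ 2) with hb
  have hbc : b ≤ Real.exp (-c * t ^ 2) := by
    apply Real.exp_le_exp.2
    nlinarith [sq_nonneg t]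
  have ht2 : t ^ 2 ≤ T ^ 2 := by rw [← sq_abs t]; gcongr
  have h4 : ‖γ - b + Complex.I * (m₃ * t ^ 3 / 6 : ℝ)‖ ≤ A * t ^ 4 := by
    have e : γ - b + Complex.I * (m₃ * t ^ 3 / 6 : ℝ)
        = (γ - (1 - (s * t ^ 2 / 2 : ℝ) - Complex.I * (m₃ * t ^ 3 / 6 : ℝ)))
          - ((b - (1 - s * t ^ 2 / 2) : ℝ) : ℂ) := by
      push_cast
      ring
    rw [e]
    refine (norm_sub_le _ _).trans ?_
    rw [Complex.norm_real, Real.norm_eq_abs]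
    have h5 := Real.abs_exp_neg_sub_one_sub_le (u := s * t ^ 2 / 2) (by positivity)
    have h6 : b = Real.exp (-(s * t ^ 2 / 2)) := by rw [hb]; ring_nf
    rw [← h6] at h5
    have h7 : (s * t ^ 2 / 2) ^ 2 / 2 ≤ M ^ 2 * t ^ 4 := by
      have : s ^ 2 ≤ M ^ 2 := by gcongr
      have h8 : (0 : ℝ) ≤ t ^ 4 := by positivity
      nlinarith [mul_le_mul_of_nonneg_right this h8, mul_nonneg (sq_nonneg s) h8]
    have := hg2
    rw [hA]
    linarith
  have h3 : ‖γ - b‖ ≤ B * |t| ^ 3 := by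
    have e : γ - b = (γ - b + Complex.I * (m₃ * t ^ 3 / 6 : ℝ))
        - Complex.I * (m₃ * t ^ 3 / 6 : ℝ) := by ring
    rw [e]
    refine (norm_sub_le _ _).trans ?_
    have h5 : ‖Complex.I * ((m₃ * t ^ 3 / 6 : ℝ) : ℂ)‖ ≤ M * |t| ^ 3 := by
      rw [norm_mul, Complex.norm_I, one_mul, Complex.norm_real, Real.norm_eq_abs, abs_div,
        abs_mul, abs_pow, abs_of_pos (by norm_num : (0 : ℝ) < 6)]
      have h8 : (0 : ℝ) ≤ |t| ^ 3 := by positivity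
      have := mul_le_mul_of_nonneg_right hm h8
      have := mul_nonneg (abs_nonneg m₃) h8
      linarith
    have h6 : A * t ^ 4 ≤ A * T * |t| ^ 3 := by
      have : t ^ 4 = |t| * |t| ^ 3 := by
        rw [← pow_succ', show (3 + 1) = 2 * 2 from rfl, pow_mul |t|, sq_abs, ← pow_mul]
      rw [this, ← mul_assoc]
      gcongr
    rw [hB]
    linarith
  obtain ⟨n, rfl⟩ : ∃ n, N = n + 2 := ⟨N - 2, by omega⟩
  set ρ := Real.exp (-c * t ^ 2) with hρ
  have hρ0 : 0 ≤ ρ := Real.exp_nonneg _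
  have hnb : ‖(b : ℂ)‖ ≤ ρ := by
    rw [Complex.norm_real, Real.norm_of_nonneg (Real.exp_nonneg _)]
    exact hbc
  have hpow := norm_pow_sub_pow_sub_le hg1 hnb n
  have e : γ ^ (n + 2) - (b : ℂ) ^ (n + 2) + Complex.I
        * (((n + 2 : ℕ) * m₃ / 6 * (b ^ (n + 2 - 1) * t ^ 3) : ℝ) : ℂ) = (γ ^ (n + 2) - (b : ℂ) ^ (n + 2) - (n + 2) * (b : ℂ) ^ (n + 1) * (γ - b))
      + (n + 2) * (b : ℂ) ^ (n + 1) * (γ - b + Complex.I * (m₃ * t ^ 3 / 6 : ℝ)) := by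
    simp only [show n + 2 - 1 = n + 1 from rfl]
    push_cast
    ring
  have hsecond : ‖((n : ℂ) + 2) * (b : ℂ) ^ (n + 1)
      * (γ - b + Complex.I * (m₃ * t ^ 3 / 6 : ℝ))‖
      ≤ ((n : ℝ) + 2) * ρ ^ n * (A * t ^ 4) := by
    rw [norm_mul, norm_mul, norm_pow]
    have : ‖(n : ℂ) + 2‖ = (n : ℝ) + 2 := by
      rw [show (n : ℂ) + 2 = ((n + 2 : ℕ) : ℂ) by push_cast; ring, Complex.norm_natCast]
      push_cast
      ring
    rw [this]
    have hρ1 : ρ ≤ 1 := by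
      rw [hρ, Real.exp_le_one_iff]
      nlinarith [sq_nonneg t]
    have : ‖(b : ℂ)‖ ^ (n + 1) ≤ ρ ^ n :=
      (pow_le_pow_left₀ (norm_nonneg _) hnb _).trans (pow_le_pow_of_le_one hρ0 hρ1 n.le_succ)
    gcongr
  have hρn : ρ ^ n ≤ Real.exp (2 * c * T ^ 2) * Real.exp (-(c * (n + 2)) * t ^ 2) := by
    rw [hρ, ← Real.exp_nat_mul, ← Real.exp_add]
    apply Real.exp_le_exp.2
    nlinarith
  have hx : 0 < c * ((n : ℝ) + 2) := by positivity
  have hexp3 := pow_mul_exp_neg_le hx t 3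
  have hexp2 := pow_mul_exp_neg_le hx t 2
  set e1 := Real.exp (-(c * ((n : ℝ) + 2)) * t ^ 2) with he1
  have e2 : Real.exp (-(c * ((n + 2 : ℕ) : ℝ) / 2) * t ^ 2)
      = Real.exp (-(c * ((n : ℝ) + 2) / 2) * t ^ 2) := by
    push_cast
    ring_nf
  rw [e2]
  set e3 := Real.exp (-(c * ((n : ℝ) + 2) / 2) * t ^ 2) with he3
  rw [e]
  have h3' : ‖γ - b‖ ^ 2 ≤ B ^ 2 * t ^ 6 := by
    calc ‖γ - b‖ ^ 2 ≤ (B * |t| ^ 3) ^ 2 := by gcongr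
      _ = B ^ 2 * (|t| ^ 2) ^ 3 := by ring
      _ = _ := by rw [sq_abs]; ring
  calc _ ≤ ((n : ℝ) + 2) ^ 2 * ρ ^ n * ‖γ - b‖ ^ 2 + ((n : ℝ) + 2) * ρ ^ n * (A * t ^ 4) :=
        (norm_add_le _ _).trans (add_le_add hpow hsecond)
    _ ≤ ((n : ℝ) + 2) ^ 2 * ρ ^ n * (B ^ 2 * t ^ 6) + ((n : ℝ) + 2) * ρ ^ n * (A * t ^ 4) := by
        gcongr
    _ = ρ ^ n * (((n : ℝ) + 2) ^ 2 * B ^ 2 * t ^ 6 + ((n : ℝ) + 2) * A * t ^ 4) := by ring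
    _ ≤ (Real.exp (2 * c * T ^ 2) * e1)
          * (((n : ℝ) + 2) ^ 2 * B ^ 2 * t ^ 6 + ((n : ℝ) + 2) * A * t ^ 4) := by
        gcongr
    _ = Real.exp (2 * c * T ^ 2) * (((n : ℝ) + 2) ^ 2 * B ^ 2 * (t ^ (2 * 3) * e1)
          + ((n : ℝ) + 2) * A * (t ^ (2 * 2) * e1)) := by ring
    _ ≤ Real.exp (2 * c * T ^ 2) * (((n : ℝ) + 2) ^ 2 * B ^ 2
            * ((Nat.factorial 3) * 2 ^ 3 / (c * ((n : ℝ) + 2)) ^ 3 * e3)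
          + ((n : ℝ) + 2) * A * ((Nat.factorial 2) * 2 ^ 2 / (c * ((n : ℝ) + 2)) ^ 2 * e3)) := by
        gcongr
    _ = _ := by
        push_cast
        simp only [Nat.factorial]
        field_simp
        push_cast
        ring

/-- Laplace's method with error term `O(1 / N)`. The comparison with the Gaussian
`b = exp (-s t ^ 2 / 2)` uses `g ^ N = b ^ N + N b ^ (N - 1) (g - b) + O(N ^ 2 (g - b) ^ 2)`; the
cubic part of `g - b` is odd and integrates to zero. -/
theorem norm_integral_pow_sub_gaussian_le {c M T : ℝ} (hc : 0 < c) (hT : 0 < T) (hM : 0 ≤ M) :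
    ∃ C : ℝ, 0 ≤ C ∧ ∀ (s m₃ : ℝ) (g : ℝ → ℂ), Continuous g → 2 * c ≤ s → s ≤ M → |m₃| ≤ M →
      (∀ t, |t| ≤ T → ‖g t‖ ≤ Real.exp (-c * t ^ 2)) →
      (∀ t, |t| ≤ T →
        ‖g t - (1 - (s * t ^ 2 / 2 : ℝ) - Complex.I * (m₃ * t ^ 3 / 6 : ℝ))‖ ≤ M * t ^ 4) →
      ∀ N : ℕ, 2 ≤ N → ‖(∫ t in (-T)..T, g t ^ N) - (√(2 * Real.pi / (N * s)) : ℝ)‖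
        ≤ C / N * √(2 * Real.pi / (N * s)) := by
  set K : ℝ := Real.exp (2 * c * T ^ 2)
    * (48 * (M + (M + M ^ 2) * T) ^ 2 / c ^ 3 + 8 * (M + M ^ 2) / c ^ 2) with hK
  set K' : ℝ := 2 / (c * T ^ 2) with hK'
  have hK0 : 0 ≤ K := by positivity
  have hK'0 : 0 ≤ K' := by positivity
  refine ⟨(K + K') * √(M / c), by positivity, ?_⟩
  intro s m₃ g hg hcs hsM hm hg1 hg2 N hN
  have hs : 0 < s := by linarith
  have hN0 : (0 : ℝ) < N := by exact_mod_cast (by omega : 0 < N)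
  set b : ℝ → ℝ := fun t => Real.exp (-(s / 2) * t ^ 2) with hb
  have hbN : ∀ t, b t ^ N = Real.exp (-(N * s / 2) * t ^ 2) := by
    intro t
    rw [hb, ← Real.exp_nat_mul]
    ring_nf
  have hbc : ∀ t, b t ≤ Real.exp (-c * t ^ 2) := by
    intro t
    apply Real.exp_le_exp.2
    nlinarith [sq_nonneg t]
  have hbcont : Continuous b := by fun_prop
  -- the integrand without its Gaussian and odd parts
  set E : ℝ → ℂ := fun t => g t ^ N - (b t : ℂ) ^ N
    + Complex.I * ((N * m₃ / 6 * (b t ^ (N - 1) * t ^ 3) : ℝ) : ℂ) with hE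
  have hEcont : Continuous E := by fun_prop
  have hEle : ∀ t, |t| ≤ T → ‖E t‖ ≤ K / N * Real.exp (-(c * N / 2) * t ^ 2) := by
    intro t ht
    exact norm_pow_sub_gaussian_pow_le hc hT hM hcs hsM hm ht (hg1 t ht) (hg2 t ht) hN
  have hxN : 0 < c * N / 2 := by positivity
  have hgauss : MeasureTheory.Integrable (fun t : ℝ => Real.exp (-(c * N / 2) * t ^ 2)) :=
    integrable_exp_neg_mul_sq hxN
  have hgaussb : MeasureTheory.Integrable (fun t : ℝ => b t ^ N) := by
    simp only [hbN]
    exact integrable_exp_neg_mul_sq (by positivity)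
  set J : ℝ := ∫ t : ℝ, Real.exp (-(c * N / 2) * t ^ 2) with hJ
  have hTT : -T ≤ T := by linarith
  -- the error part
  have hEint : ‖∫ t in (-T)..T, E t‖ ≤ K / N * J := by
    rw [intervalIntegral.integral_of_le hTT]
    rw [hJ, ← MeasureTheory.integral_const_mul]
    refine (MeasureTheory.norm_integral_le_integral_norm _).trans ?_
    calc ∫ t in Set.Ioc (-T) T, ‖E t‖
        ≤ ∫ t in Set.Ioc (-T) T, K / N * Real.exp (-(c * N / 2) * t ^ 2) := by
          refine MeasureTheory.setIntegral_mono_on ?_ (hgauss.const_mul _).integrableOn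
            measurableSet_Ioc ?_
          · exact (hEcont.norm.continuousOn.integrableOn_compact isCompact_Icc).mono_set
              Set.Ioc_subset_Icc_self
          · intro t ht
            exact hEle t (abs_le.2 ⟨ht.1.le, ht.2⟩)
      _ ≤ _ := by
          refine MeasureTheory.setIntegral_le_integral (hgauss.const_mul _) ?_
          exact Filter.Eventually.of_forall fun t => by positivity
  -- the odd part
  have hodd : ∫ t in (-T)..T, b t ^ (N - 1) * t ^ 3 = 0 := by
    have h := intervalIntegral.integral_comp_neg (a := -T) (b := T)
      (fun t => b t ^ (N - 1) * t ^ 3)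
    have h2 : ∀ t : ℝ, b (-t) ^ (N - 1) * (-t) ^ 3 = -(b t ^ (N - 1) * t ^ 3) := by
      intro t
      simp only [hb]
      rw [neg_sq]
      ring
    simp only [h2, intervalIntegral.integral_neg, neg_neg] at h
    linarith
  -- the tail of the Gaussian
  have htail : |(∫ t in (-T)..T, b t ^ N) - √(2 * Real.pi / (N * s))| ≤ K' / N * J := by
    have hfull : √(2 * Real.pi / (N * s)) = ∫ t : ℝ, b t ^ N := by
      simp only [hbN]
      rw [integral_gaussian]
      congr 1
      field_simp
    rw [hfull, intervalIntegral.integral_of_le hTT,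
      ← MeasureTheory.integral_add_compl measurableSet_Ioc hgaussb]
    rw [sub_add_cancel_left, abs_neg, abs_of_nonneg (MeasureTheory.integral_nonneg fun t => by
      simp only [hb]; positivity)]
    rw [hJ, ← MeasureTheory.integral_const_mul]
    calc ∫ t in (Set.Ioc (-T) T)ᶜ, b t ^ N
        ≤ ∫ t in (Set.Ioc (-T) T)ᶜ, K' / N * Real.exp (-(c * N / 2) * t ^ 2) := by
          refine MeasureTheory.setIntegral_mono_on hgaussb.integrableOn
            (hgauss.const_mul _).integrableOn measurableSet_Ioc.compl ?_
          intro t ht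
          have ht2 : T ^ 2 ≤ t ^ 2 := by
            by_contra! h
            have := abs_lt_of_sq_lt_sq h hT.le
            exact ht ⟨(abs_lt.1 this).1, (abs_lt.1 this).2.le⟩
          have h1 := pow_mul_exp_neg_le (x := c * N) (by positivity) t 1
          have h2 : b t ^ N ≤ Real.exp (-(c * N) * t ^ 2) := by
            rw [hbN]
            apply Real.exp_le_exp.2
            have : c * N ≤ N * s / 2 := by nlinarith
            nlinarith [sq_nonneg t]
          have h3 : T ^ 2 * Real.exp (-(c * N) * t ^ 2)
              ≤ T ^ 2 * (K' / N * Real.exp (-(c * N / 2) * t ^ 2)) := by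
            calc T ^ 2 * Real.exp (-(c * N) * t ^ 2)
                ≤ t ^ (2 * 1) * Real.exp (-(c * N) * t ^ 2) := by
                  rw [mul_one]
                  gcongr
              _ ≤ _ := h1
              _ = _ := by
                  rw [hK']
                  simp only [Nat.factorial]
                  push_cast
                  field_simp
          exact h2.trans (le_of_mul_le_mul_left h3 (by positivity))
      _ ≤ _ := by
          refine MeasureTheory.setIntegral_le_integral (hgauss.const_mul _) ?_
          exact Filter.Eventually.of_forall fun t => by positivity
  have hsplit : (∫ t in (-T)..T, g t ^ N) - ((√(2 * Real.pi / (N * s)) : ℝ) : ℂ)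
      = (∫ t in (-T)..T, E t)
        + (((∫ t in (-T)..T, b t ^ N) - √(2 * Real.pi / (N * s)) : ℝ) : ℂ) := by
    have h1 : ∀ t, g t ^ N = E t + ((b t ^ N : ℝ) : ℂ)
        - Complex.I * ((N * m₃ / 6 * (b t ^ (N - 1) * t ^ 3) : ℝ) : ℂ) := by
      intro t
      simp only [hE]
      push_cast
      ring
    have i1 : IntervalIntegrable E MeasureTheory.volume (-T) T := hEcont.intervalIntegrable _ _
    have i2 : IntervalIntegrable (fun t => ((b t ^ N : ℝ) : ℂ)) MeasureTheory.volume (-T) T :=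
      (by fun_prop : Continuous fun t => ((b t ^ N : ℝ) : ℂ)).intervalIntegrable _ _
    have i3 : IntervalIntegrable (fun t => Complex.I
        * ((N * m₃ / 6 * (b t ^ (N - 1) * t ^ 3) : ℝ) : ℂ)) MeasureTheory.volume (-T) T :=
      (by fun_prop : Continuous fun t => Complex.I
        * ((N * m₃ / 6 * (b t ^ (N - 1) * t ^ 3) : ℝ) : ℂ)).intervalIntegrable _ _
    simp only [h1]
    rw [intervalIntegral.integral_sub (i1.add i2) i3, intervalIntegral.integral_add i1 i2,
      intervalIntegral.integral_const_mul, intervalIntegral.integral_ofReal,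
      intervalIntegral.integral_ofReal, intervalIntegral.integral_const_mul, hodd]
    push_cast
    ring
  have hJle : J ≤ √(M / c) * √(2 * Real.pi / (N * s)) := by
    rw [hJ, integral_gaussian, ← Real.sqrt_mul (by positivity)]
    apply Real.sqrt_le_sqrt
    have : M / c * (2 * Real.pi / (N * s)) = (M / s) * (Real.pi / (c * N / 2)) := by
      field_simp
    rw [this]
    exact le_mul_of_one_le_left (by positivity) ((one_le_div hs).2 hsM)
  rw [hsplit]
  refine (norm_add_le _ _).trans ?_
  rw [Complex.norm_real, Real.norm_eq_abs]
  calc _ ≤ K / N * J + K' / N * J := add_le_add hEint htail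
    _ = (K + K') / N * J := by ring
    _ ≤ (K + K') / N * (√(M / c) * √(2 * Real.pi / (N * s))) := by gcongr
    _ = _ := by ring

/-! ### Characteristic functions of lattice distributions -/

open Complex in
theorem norm_exp_I_mul_sub_taylor_le (x : ℝ) :
    ‖cexp (I * x) - (1 + I * x - (x ^ 2 / 2 : ℝ) - I * (x ^ 3 / 6 : ℝ))‖ ≤ 4 * x ^ 4 := by
  have hx4 : x ^ 4 = |x| ^ 4 := by rw [show 4 = 2 * 2 from rfl, pow_mul, pow_mul, sq_abs]
  have hI3 : I ^ 3 = -I := by rw [pow_succ, I_sq]; ring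
  have e : (1 + I * x - (x ^ 2 / 2 : ℝ) - I * (x ^ 3 / 6 : ℝ) : ℂ)
      = ∑ m ∈ Finset.range 4, (I * x) ^ m / (m.factorial : ℂ) := by
    simp only [Finset.sum_range_succ, Finset.sum_range_zero, Nat.factorial, mul_pow, I_sq, hI3]
    push_cast
    ring
  by_cases hx : |x| ≤ 1
  · have h := Complex.exp_bound (x := I * x) (by simpa using hx) (n := 4) (by norm_num)
    rw [e]
    refine h.trans ?_
    rw [norm_mul, norm_I, one_mul, norm_real, Real.norm_eq_abs, ← hx4]
    have : (0 : ℝ) ≤ x ^ 4 := by positivity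
    norm_num [Nat.factorial]
    linarith
  -- for `|x| > 1`, each term is at most a multiple of `x ^ 4`
  · push Not at hx
    have h1 : ‖cexp (I * x)‖ = 1 := norm_exp_I_mul_ofReal x
    have h2 : ‖(1 + I * x - (x ^ 2 / 2 : ℝ) - I * (x ^ 3 / 6 : ℝ) : ℂ)‖
        ≤ 1 + |x| + |x| ^ 2 / 2 + |x| ^ 3 / 6 := by
      refine (norm_sub_le _ _).trans ?_
      refine add_le_add ((norm_sub_le _ _).trans (add_le_add ((norm_add_le _ _).trans ?_) ?_)) ?_
      · simp
      · rw [norm_real, Real.norm_eq_abs, abs_div, abs_pow]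
        simp
      · rw [norm_mul, norm_I, one_mul, norm_real, Real.norm_eq_abs, abs_div, abs_pow]
        simp
    have h3 : |x| ≤ |x| ^ 4 := le_self_pow₀ hx.le (by norm_num)
    have h4 : |x| ^ 2 ≤ |x| ^ 4 := pow_le_pow_right₀ hx.le (by norm_num)
    have h5 : |x| ^ 3 ≤ |x| ^ 4 := pow_le_pow_right₀ hx.le (by norm_num)
    have h6 : 1 ≤ |x| ^ 4 := one_le_pow₀ hx.le
    refine (norm_sub_le _ _).trans ?_
    rw [hx4]
    linarith

open Complex in
/-- Third order Taylor expansion at `0` of the characteristic function of a centred distribution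
with weights `w d` at the points `δ d`. -/
theorem norm_charSum_sub_taylor_le {w δ : ℕ → ℝ} {s m₃ m₄ : ℝ} (hw : ∀ d, 0 ≤ w d)
    (h0 : HasSum w 1) (h1 : HasSum (fun d => w d * δ d) 0) (h2 : HasSum (fun d => w d * δ d ^ 2) s)
    (h3 : HasSum (fun d => w d * δ d ^ 3) m₃) (h4 : HasSum (fun d => w d * δ d ^ 4) m₄) (t : ℝ) :
    ‖(∑' d, (w d : ℂ) * cexp (I * (δ d * t : ℝ)))
        - (1 - (s * t ^ 2 / 2 : ℝ) - I * (m₃ * t ^ 3 / 6 : ℝ))‖ ≤ 4 * m₄ * t ^ 4 := by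
  have hsum : Summable fun d => (w d : ℂ) * cexp (I * (δ d * t : ℝ)) := by
    refine Summable.of_norm ?_
    simpa [norm_mul, norm_exp_I_mul_ofReal, abs_of_nonneg (hw _), -ofReal_mul] using h0.summable
  have c0 := (hasSum_ofReal (L := .unconditional ℕ)).2 h0
  have c1 := ((hasSum_ofReal (L := .unconditional ℕ)).2 h1).mul_left (I * t)
  have c2 := ((hasSum_ofReal (L := .unconditional ℕ)).2 h2).mul_left ((t : ℂ) ^ 2 / 2)
  have c3 := ((hasSum_ofReal (L := .unconditional ℕ)).2 h3).mul_left (I * t ^ 3 / 6)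
  have key := hsum.hasSum.sub (((c0.add c1).sub c2).sub c3)
  have e : (((1 : ℝ) : ℂ) + I * t * ((0 : ℝ) : ℂ) - (t : ℂ) ^ 2 / 2 * (s : ℂ)
      - I * t ^ 3 / 6 * (m₃ : ℂ)) = 1 - (s * t ^ 2 / 2 : ℝ) - I * (m₃ * t ^ 3 / 6 : ℝ) := by
    push_cast
    ring
  rw [e] at key
  rw [← key.tsum_eq]
  have hb := (h4.mul_left (4 * t ^ 4))
  rw [show 4 * t ^ 4 * m₄ = 4 * m₄ * t ^ 4 by ring] at hb
  refine tsum_of_norm_bounded hb fun d => ?_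
  have e2 : (w d : ℂ) * cexp (I * (δ d * t : ℝ)) - ((w d : ℂ) + I * t * ((w d * δ d : ℝ) : ℂ)
        - (t : ℂ) ^ 2 / 2 * ((w d * δ d ^ 2 : ℝ) : ℂ)
        - I * t ^ 3 / 6 * ((w d * δ d ^ 3 : ℝ) : ℂ))
      = w d * (cexp (I * (δ d * t : ℝ)) - (1 + I * (δ d * t : ℝ) - ((δ d * t) ^ 2 / 2 : ℝ)
          - I * ((δ d * t) ^ 3 / 6 : ℝ))) := by
    push_cast
    ring
  rw [e2, norm_mul, norm_real, Real.norm_of_nonneg (hw d)]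
  calc _ ≤ w d * (4 * (δ d * t) ^ 4) :=
        mul_le_mul_of_nonneg_left (norm_exp_I_mul_sub_taylor_le _) (hw d)
    _ = _ := by ring

open Complex in
theorem norm_add_exp_le {a b α β : ℝ} (ha : 0 ≤ a) (hb : 0 ≤ b) (hab : a + b ≤ 1) :
    ‖(a : ℂ) * cexp (I * α) + b * cexp (I * β)‖
      ≤ a + b - 2 * (a * b) * Real.sin ((α - β) / 2) ^ 2 := by
  set S := Real.sin ((α - β) / 2) ^ 2 with hS
  have hS1 : S ≤ 1 := Real.sin_sq_le_one _
  have hS0 : 0 ≤ S := sq_nonneg _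
  have hcos : Real.cos (α - β) = 1 - 2 * S := by
    have h1 := Real.cos_two_mul ((α - β) / 2)
    have h2 := Real.sin_sq_add_cos_sq ((α - β) / 2)
    rw [mul_div_cancel₀ _ (two_ne_zero)] at h1
    rw [hS]
    linarith
  have hab0 : 0 ≤ a * b := mul_nonneg ha hb
  have hsq : ‖(a : ℂ) * cexp (I * α) + b * cexp (I * β)‖ ^ 2 = (a + b) ^ 2 - 4 * (a * b) * S := by
    have e : (a : ℂ) * cexp (I * α) + b * cexp (I * β)
        = ((a * Real.cos α + b * Real.cos β : ℝ) : ℂ)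
          + ((a * Real.sin α + b * Real.sin β : ℝ) : ℂ) * I := by
      rw [mul_comm I, mul_comm I, exp_mul_I, exp_mul_I]
      push_cast
      ring
    rw [e, Complex.sq_norm, normSq_add_mul_I]
    have h1 := Real.sin_sq_add_cos_sq α
    have h2 := Real.sin_sq_add_cos_sq β
    have h3 := Real.cos_sub α β
    rw [hcos] at h3
    linear_combination a ^ 2 * h1 + b ^ 2 * h2 - 2 * a * b * h3
  have hle : 2 * (a * b) * S ≤ a + b := by nlinarith
  refine (sq_le_sq₀ (norm_nonneg _) (by linarith)).1 ?_
  rw [hsq]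
  nlinarith [mul_nonneg hab0 hS0, sq_nonneg (a * b * S),
    mul_nonneg (mul_nonneg hab0 hS0) (sub_nonneg.2 hab)]

open Complex in
/-- Two atoms that are out of phase reduce the modulus of a characteristic function. -/
theorem norm_charSum_le {w : ℕ → ℝ} (hw : ∀ d, 0 ≤ w d) (h0 : HasSum w 1) (t : ℝ) (d₁ d₂ : ℕ) :
    ‖∑' d, (w d : ℂ) * cexp (I * t) ^ d‖
      ≤ 1 - 2 * (w d₁ * w d₂) * Real.sin (((d₁ : ℝ) - d₂) * t / 2) ^ 2 := by
  have hexp : ∀ d : ℕ, cexp (I * t) ^ d = cexp (I * (d * t : ℝ)) := by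
    intro d
    rw [← Complex.exp_nat_mul]
    push_cast
    ring_nf
  have hn : ∀ d, ‖(w d : ℂ) * cexp (I * t) ^ d‖ = w d := by
    intro d
    rw [norm_mul, norm_pow, norm_exp_I_mul_ofReal, one_pow, mul_one, norm_real,
      Real.norm_of_nonneg (hw d)]
  have hsn : Summable fun d => ‖(w d : ℂ) * cexp (I * t) ^ d‖ := by simpa only [hn] using h0.summable
  rcases eq_or_ne d₁ d₂ with rfl | hne
  · simp only [sub_self, zero_mul, zero_div, Real.sin_zero]
    refine (norm_tsum_le_tsum_norm hsn).trans ?_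
    simp only [hn, h0.tsum_eq]
    norm_num
  have s1 := hsn.of_norm.sum_add_tsum_compl (s := {d₁, d₂})
  have s2 := h0.summable.sum_add_tsum_compl (s := {d₁, d₂})
  rw [Finset.sum_pair hne, h0.tsum_eq] at s2
  rw [Finset.sum_pair hne] at s1
  rw [← s1]
  refine (norm_add_le _ _).trans ?_
  have hrest : ‖∑' d : ↑((({d₁, d₂} : Finset ℕ) : Set ℕ)ᶜ), (w d : ℂ) * cexp (I * t) ^ (d : ℕ)‖
      ≤ ∑' d : ↑((({d₁, d₂} : Finset ℕ) : Set ℕ)ᶜ), w d := by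
    refine (norm_tsum_le_tsum_norm (hsn.subtype _)).trans (le_of_eq ?_)
    exact tsum_congr fun d => hn d
  have hrest0 : 0 ≤ ∑' d : ↑((({d₁, d₂} : Finset ℕ) : Set ℕ)ᶜ), w d := tsum_nonneg fun d => hw d
  have h2 := norm_add_exp_le (α := d₁ * t) (β := d₂ * t) (hw d₁) (hw d₂) (by linarith)
  rw [← hexp, ← hexp, show ((d₁ : ℝ) * t - d₂ * t) / 2 = ((d₁ : ℝ) - d₂) * t / 2 by ring] at h2
  linarith

/-- `p` generates the group spanned by the differences of elements of `D`. -/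
theorem periodicity_spec {D : Set ℕ} (hD : D.Nontrivial) {r : ℕ} (hr : r ∈ D) :
    0 < periodicity D ∧ (∀ d ∈ D, (periodicity D : ℤ) ∣ (d : ℤ) - r) ∧
      (periodicity D : ℤ) ∈ AddSubgroup.closure ((fun d : ℕ => (d : ℤ) - r) '' D) := by
  set H := AddSubgroup.closure ((fun d : ℕ => (d : ℤ) - r) '' D) with hH
  obtain ⟨q, hq⟩ := Int.subgroup_cyclic H
  rw [← AddSubgroup.zmultiples_eq_closure] at hq
  have hmem : ∀ d ∈ D, (d : ℤ) - r ∈ H := fun d hd => AddSubgroup.subset_closure ⟨d, hd, rfl⟩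
  have hdvd : ∀ d ∈ D, q ∣ (d : ℤ) - r := by
    intro d hd
    have := hmem d hd
    rwa [hq, Int.mem_zmultiples_iff] at this
  have hq0 : q ≠ 0 := by
    rintro rfl
    obtain ⟨x, hx, y, hy, hxy⟩ := hD
    have h1 := zero_dvd_iff.1 (hdvd x hx)
    have h2 := zero_dvd_iff.1 (hdvd y hy)
    omega
  have hqH : q ∈ H := by
    rw [hq]
    exact AddSubgroup.mem_zmultiples q
  have hper : periodicity D = q.natAbs := by
    have hg : IsGreatest {k : ℕ | ∀ d₁ ∈ D, ∀ d₂ ∈ D, (k : ℤ) ∣ (d₁ : ℤ) - (d₂ : ℤ)} q.natAbs := by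
      constructor
      · intro d₁ h₁ d₂ h₂
        rw [Int.natAbs_dvd]
        have := dvd_sub (hdvd d₁ h₁) (hdvd d₂ h₂)
        simpa using this
      · intro k hk
        have hle : H ≤ AddSubgroup.zmultiples (k : ℤ) := by
          rw [hH, AddSubgroup.closure_le]
          rintro _ ⟨d, hd, rfl⟩
          exact Int.mem_zmultiples_iff.2 (hk d hd r hr)
        have := Int.mem_zmultiples_iff.1 (hle hqH)
        exact Nat.le_of_dvd (Int.natAbs_pos.2 hq0) (Int.natCast_dvd.1 this)
    exact hg.csSup_eq
  refine ⟨hper ▸ Int.natAbs_pos.2 hq0, fun d hd => ?_, ?_⟩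
  · rw [hper, Int.natAbs_dvd]
    exact hdvd d hd
  · rw [hper]
    rcases Int.natAbs_eq q with h | h
    · rwa [← h]
    · rw [show (q.natAbs : ℤ) = -q by omega]
      exact H.neg_mem hqH

/-- Since `|sin (x + y)| ≤ |sin x| + |sin y|`, the sine of an integer combination is controlled by
the sines of its terms. -/
theorem exists_abs_sin_le_sum {D : Set ℕ} {r : ℕ} {x : ℤ}
    (hx : x ∈ AddSubgroup.closure ((fun d : ℕ => (d : ℤ) - r) '' D)) :
    ∃ F : Finset ℕ, (F : Set ℕ) ⊆ D ∧ ∃ K : ℝ, 0 ≤ K ∧ ∀ t : ℝ,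
      |Real.sin (x * t / 2)| ≤ K * ∑ d ∈ F, |Real.sin (((d : ℝ) - r) * t / 2)| := by
  classical
  induction hx using AddSubgroup.closure_induction with
  | mem x hx =>
    obtain ⟨d, hd, rfl⟩ := hx
    refine ⟨{d}, by simpa using hd, 1, zero_le_one, fun t => ?_⟩
    simp
  | zero => exact ⟨∅, by simp, 0, le_rfl, fun t => by simp⟩
  | add x y _ _ hx hy =>
    obtain ⟨F, hF, K, hK, h⟩ := hx
    obtain ⟨F', hF', K', hK', h'⟩ := hy
    refine ⟨F ∪ F', by simp [hF, hF'], K + K', add_nonneg hK hK', fun t => ?_⟩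
    have e : ((x + y : ℤ) : ℝ) * t / 2 = x * t / 2 + y * t / 2 := by
      push_cast
      ring
    rw [e, Real.sin_add]
    have h1 : ∑ d ∈ F, |Real.sin (((d : ℝ) - r) * t / 2)|
        ≤ ∑ d ∈ F ∪ F', |Real.sin (((d : ℝ) - r) * t / 2)| :=
      Finset.sum_le_sum_of_subset_of_nonneg Finset.subset_union_left fun _ _ _ => abs_nonneg _
    have h2 : ∑ d ∈ F', |Real.sin (((d : ℝ) - r) * t / 2)|
        ≤ ∑ d ∈ F ∪ F', |Real.sin (((d : ℝ) - r) * t / 2)| :=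
      Finset.sum_le_sum_of_subset_of_nonneg Finset.subset_union_right fun _ _ _ => abs_nonneg _
    refine (abs_add_le _ _).trans ?_
    rw [abs_mul, abs_mul, add_mul]
    refine add_le_add ?_ ?_
    · calc _ ≤ |Real.sin (x * t / 2)| :=
          mul_le_of_le_one_right (abs_nonneg _) (Real.abs_cos_le_one _)
        _ ≤ _ := (h t).trans (mul_le_mul_of_nonneg_left h1 hK)
    · calc _ ≤ |Real.sin (y * t / 2)| :=
          mul_le_of_le_one_left (abs_nonneg _) (Real.abs_cos_le_one _)
        _ ≤ _ := (h' t).trans (mul_le_mul_of_nonneg_left h2 hK')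
  | neg x _ hx =>
    obtain ⟨F, hF, K, hK, h⟩ := hx
    refine ⟨F, hF, K, hK, fun t => ?_⟩
    have e : ((-x : ℤ) : ℝ) * t / 2 = -(x * t / 2) := by
      push_cast
      ring
    rw [e, Real.sin_neg, abs_neg]
    exact h t

open Complex in
/-- Gaussian decay of the characteristic function on the period `|t| ≤ π / p`, uniform over the
distributions giving mass at least `η` to each point of a suitable finite subset of `D`. -/
theorem exists_norm_charSum_le_exp {D : Set ℕ} (hD : D.Nontrivial) {r : ℕ} (hr : r ∈ D) :
    ∃ F : Finset ℕ, (F : Set ℕ) ⊆ D ∧ ∃ κ : ℝ, 0 < κ ∧ ∀ (w : ℕ → ℝ) (η : ℝ), (∀ d, 0 ≤ w d) →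
      HasSum w 1 → 0 ≤ η → (∀ d ∈ F, η ≤ w d) → ∀ t : ℝ, |t| ≤ Real.pi / periodicity D →
      ‖∑' d, (w d : ℂ) * cexp (I * t) ^ d‖ ≤ Real.exp (-(κ * η ^ 2) * t ^ 2) := by
  classical
  obtain ⟨hp, -, hpH⟩ := periodicity_spec hD hr
  set p := periodicity D with hpdef
  obtain ⟨F, hF, K, hK, hsin⟩ := exists_abs_sin_le_sum hpH
  set L : ℝ := K ^ 2 * F.card ^ 2 + 1 with hL
  have hL0 : 0 < L := by positivity
  have hp' : (0 : ℝ) < p := by exact_mod_cast hp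
  refine ⟨insert r F, ?_, 2 * (p / Real.pi) ^ 2 / L, by positivity, ?_⟩
  · rw [Finset.coe_insert]
    exact Set.insert_subset hr hF
  intro w η hw h0 hη hwη t ht
  set χ := ‖∑' d, (w d : ℂ) * cexp (I * t) ^ d‖ with hχ
  have hχ1 : χ ≤ 1 := by
    simpa using norm_charSum_le hw h0 t r r
  have hd : ∀ d ∈ F, 2 * η ^ 2 * Real.sin (((d : ℝ) - r) * t / 2) ^ 2 ≤ 1 - χ := by
    intro d hd
    have h1 := norm_charSum_le hw h0 t d r
    have h2 : η * η ≤ w d * w r :=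
      mul_le_mul (hwη d (Finset.mem_insert_of_mem hd)) (hwη r (Finset.mem_insert_self _ _)) hη (hw d)
    have h3 := mul_le_mul_of_nonneg_right h2 (sq_nonneg (Real.sin (((d : ℝ) - r) * t / 2)))
    nlinarith
  have hsum : ∑ d ∈ F, 2 * η ^ 2 * Real.sin (((d : ℝ) - r) * t / 2) ^ 2 ≤ F.card * (1 - χ) :=
    (Finset.sum_le_sum hd).trans_eq (by rw [Finset.sum_const, nsmul_eq_mul])
  have hsq : Real.sin ((p : ℝ) * t / 2) ^ 2
      ≤ K ^ 2 * (F.card * ∑ d ∈ F, Real.sin (((d : ℝ) - r) * t / 2) ^ 2) := by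
    have h1 : |Real.sin ((p : ℝ) * t / 2)| ≤ K * ∑ d ∈ F, |Real.sin (((d : ℝ) - r) * t / 2)| := by
      simpa using hsin t
    have h2 := sq_sum_le_card_mul_sum_sq (s := F)
      (f := fun d => |Real.sin (((d : ℝ) - r) * t / 2)|)
    simp only [sq_abs] at h2
    calc Real.sin ((p : ℝ) * t / 2) ^ 2 = |Real.sin ((p : ℝ) * t / 2)| ^ 2 := (sq_abs _).symm
      _ ≤ (K * ∑ d ∈ F, |Real.sin (((d : ℝ) - r) * t / 2)|) ^ 2 := by gcongr
      _ = K ^ 2 * (∑ d ∈ F, |Real.sin (((d : ℝ) - r) * t / 2)|) ^ 2 := by ring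
      _ ≤ _ := by gcongr
  have hsinlow : (p / Real.pi) ^ 2 * t ^ 2 ≤ Real.sin ((p : ℝ) * t / 2) ^ 2 := by
    have hpt : |(p : ℝ) * t / 2| ≤ Real.pi / 2 := by
      rw [abs_div, abs_mul, abs_of_pos hp', abs_two]
      rw [le_div_iff₀ hp'] at ht
      linarith
    have h1 := Real.mul_abs_le_abs_sin hpt
    have h2 : (2 / Real.pi * |(p : ℝ) * t / 2|) ^ 2 ≤ |Real.sin ((p : ℝ) * t / 2)| ^ 2 := by gcongr
    rw [sq_abs, mul_pow, sq_abs] at h2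
    convert h2 using 1
    field_simp
  have hfin : 2 * η ^ 2 * ((p / Real.pi) ^ 2 * t ^ 2) ≤ L * (1 - χ) := by
    have h1 : 2 * η ^ 2 * Real.sin ((p : ℝ) * t / 2) ^ 2
        ≤ K ^ 2 * F.card * (F.card * (1 - χ)) := by
      calc 2 * η ^ 2 * Real.sin ((p : ℝ) * t / 2) ^ 2
          ≤ 2 * η ^ 2 * (K ^ 2 * (F.card * ∑ d ∈ F, Real.sin (((d : ℝ) - r) * t / 2) ^ 2)) := by
            gcongr
        _ = K ^ 2 * F.card * ∑ d ∈ F, 2 * η ^ 2 * Real.sin (((d : ℝ) - r) * t / 2) ^ 2 := by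
            rw [← Finset.mul_sum]
            ring
        _ ≤ _ := by gcongr
    have h2 : 2 * η ^ 2 * ((p / Real.pi) ^ 2 * t ^ 2)
        ≤ 2 * η ^ 2 * Real.sin ((p : ℝ) * t / 2) ^ 2 := by gcongr
    rw [hL]
    nlinarith
  have h1 := Real.add_one_le_exp (-(2 * (p / Real.pi) ^ 2 / L * η ^ 2) * t ^ 2)
  refine le_trans ?_ h1
  have h2 : 2 * (p / Real.pi) ^ 2 / L * η ^ 2 * t ^ 2 ≤ 1 - χ := by
    rw [← div_le_iff₀' hL0] at hfin
    refine le_trans (le_of_eq ?_) hfin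
    ring
  linarith

/-! ### The generating function, `φ` and the Boltzmann distribution -/

theorem HasSum.of_forall_eq {f g : ℕ → ℝ} {a : ℝ} (hg : HasSum g a) (h : ∀ d, f d = g d) :
    HasSum f a := by
  rwa [funext h]

theorem egfCoeff_nonneg (D : Set ℕ) (d : ℕ) : 0 ≤ egfCoeff D d := by
  unfold egfCoeff
  split_ifs <;> positivity

theorem egfCoeff_le (D : Set ℕ) (d : ℕ) : egfCoeff D d ≤ 1 / (d.factorial : ℝ) := by
  unfold egfCoeff
  split_ifs
  · exact le_rfl
  · positivity

theorem egfCoeff_of_mem {D : Set ℕ} {d : ℕ} (hd : d ∈ D) :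
    egfCoeff D d = 1 / (d.factorial : ℝ) := if_pos hd

theorem egfCoeff_of_notMem {D : Set ℕ} {d : ℕ} (hd : d ∉ D) : egfCoeff D d = 0 := if_neg hd

theorem succ_mul_egfCoeff_succ (D : Set ℕ) (d : ℕ) :
    ((d : ℝ) + 1) * egfCoeff D (d + 1) = egfCoeff (shiftSet D 1) d := by
  by_cases h : d + 1 ∈ D
  · rw [egfCoeff_of_mem h, egfCoeff_of_mem (show d ∈ shiftSet D 1 from h), Nat.factorial_succ]
    push_cast
    field_simp
  · rw [egfCoeff_of_notMem h, egfCoeff_of_notMem (show d ∉ shiftSet D 1 from h), mul_zero]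

theorem hasSum_setGF (D : Set ℕ) (x : ℝ) :
    HasSum (fun d => egfCoeff D d * x ^ d) (setGF D x) := by
  classical
  have h := (setGF_summable D x).hasSum
  rw [← setGF, ← Function.comp_def (fun d : ℕ => x ^ d / (d.factorial : ℝ)),
    hasSum_subtype_iff_indicator] at h
  convert h using 2 with d
  by_cases hd : d ∈ D
  · rw [Set.indicator_of_mem hd, egfCoeff_of_mem hd]
    ring
  · rw [Set.indicator_of_notMem hd, egfCoeff_of_notMem hd, zero_mul]

theorem setGF_pos {D : Set ℕ} (hD : D.Nonempty) {x : ℝ} (hx : 0 < x) : 0 < setGF D x := by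
  obtain ⟨d, hd⟩ := hD
  have h := le_hasSum (hasSum_setGF D x) d fun j _ => mul_nonneg (egfCoeff_nonneg D j) (by positivity)
  refine lt_of_lt_of_le ?_ h
  rw [egfCoeff_of_mem hd]
  positivity

theorem setGF_mono (D : Set ℕ) {x y : ℝ} (hx : 0 ≤ x) (hxy : x ≤ y) : setGF D x ≤ setGF D y :=
  hasSum_le (fun d => mul_le_mul_of_nonneg_left (pow_le_pow_left₀ hx hxy d) (egfCoeff_nonneg D d))
    (hasSum_setGF D x) (hasSum_setGF D y)

theorem hasSum_natCast_mul_setGF (D : Set ℕ) (x : ℝ) :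
    HasSum (fun d : ℕ => (d : ℝ) * (egfCoeff D d * x ^ d)) (x * setGF (shiftSet D 1) x) := by
  rw [← hasSum_nat_add_iff' 1]
  simp only [Finset.sum_range_one, Nat.cast_zero, zero_mul, sub_zero]
  refine HasSum.of_forall_eq ((hasSum_setGF (shiftSet D 1) x).mul_left x) fun d => ?_
  rw [← succ_mul_egfCoeff_succ]
  push_cast
  ring

theorem hasSum_natCast_mul_pred_mul_setGF (D : Set ℕ) (x : ℝ) :
    HasSum (fun d : ℕ => (d : ℝ) * (d - 1) * (egfCoeff D d * x ^ d))
      (x ^ 2 * setGF (shiftSet (shiftSet D 1) 1) x) := by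
  rw [← hasSum_nat_add_iff' 1]
  simp only [Finset.sum_range_one, Nat.cast_zero, zero_mul, sub_zero]
  rw [pow_two, mul_assoc]
  refine HasSum.of_forall_eq ((hasSum_natCast_mul_setGF (shiftSet D 1) x).mul_left x) fun d => ?_
  rw [← succ_mul_egfCoeff_succ]
  push_cast
  ring

theorem hasDerivAt_setGF (D : Set ℕ) (x : ℝ) :
    HasDerivAt (setGF D) (setGF (shiftSet D 1) x) x := by
  have hfun : setGF D = fun y => ∑' d, egfCoeff D d * y ^ d :=
    funext fun y => (hasSum_setGF D y).tsum_eq.symm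
  have hval : setGF (shiftSet D 1) x = ∑' d : ℕ, egfCoeff D d * ((d : ℝ) * x ^ (d - 1)) := by
    symm
    apply HasSum.tsum_eq
    rw [← hasSum_nat_add_iff' 1]
    simp only [Finset.sum_range_one, Nat.cast_zero, zero_mul, mul_zero, sub_zero,
      Nat.add_sub_cancel]
    refine HasSum.of_forall_eq (hasSum_setGF (shiftSet D 1) x) fun d => ?_
    rw [← succ_mul_egfCoeff_succ]
    push_cast
    ring
  rw [hfun, hval]
  have hsum : Summable fun d : ℕ => egfCoeff D d * ((d : ℝ) * (|x| + 1) ^ (d - 1)) := by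
    rw [← summable_nat_add_iff 1]
    simp only [Nat.add_sub_cancel]
    refine (hasSum_setGF (shiftSet D 1) (|x| + 1)).summable.congr fun d => ?_
    rw [← succ_mul_egfCoeff_succ]
    push_cast
    ring
  refine hasDerivAt_tsum_of_isPreconnected (t := Metric.ball 0 (|x| + 1)) (y₀ := x) hsum
    Metric.isOpen_ball (convex_ball _ _).isPreconnected
    (fun d y _ => (hasDerivAt_pow d y).const_mul _) (fun d y hy => ?_) (by simp)
    (hasSum_setGF D x).summable (by simp)
  rw [Real.norm_eq_abs, abs_mul, abs_mul, abs_pow, abs_of_nonneg (egfCoeff_nonneg D d), Nat.abs_cast]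
  have hy' : |y| ≤ |x| + 1 := by simpa using (Metric.mem_ball.1 hy).le
  have := egfCoeff_nonneg D d
  gcongr

/-- The Boltzmann distribution on `D` with parameter `x`, which gives `d ∈ D` the mass
`x ^ d / (d! Set_D(x))`. -/
noncomputable def boltzmann (D : Set ℕ) (x : ℝ) (d : ℕ) : ℝ := egfCoeff D d * x ^ d / setGF D x

section Boltzmann

variable {D : Set ℕ} {x : ℝ}

theorem boltzmann_nonneg (hD : D.Nonempty) (hx : 0 < x) (d : ℕ) : 0 ≤ boltzmann D x d :=
  div_nonneg (mul_nonneg (egfCoeff_nonneg D d) (by positivity)) (setGF_pos hD hx).le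

theorem hasSum_boltzmann (hD : D.Nonempty) (hx : 0 < x) : HasSum (boltzmann D x) 1 := by
  have h := (hasSum_setGF D x).div_const (setGF D x)
  rwa [div_self (setGF_pos hD hx).ne'] at h

/-- `φ(x)` is the mean of the Boltzmann distribution. -/
theorem hasSum_boltzmann_mul (D : Set ℕ) (x : ℝ) :
    HasSum (fun d => boltzmann D x d * (d : ℝ)) (phi D x) := by
  refine HasSum.of_forall_eq ((hasSum_natCast_mul_setGF D x).div_const (setGF D x)) fun d => ?_
  rw [boltzmann]
  ring

theorem hasDerivAt_phi (hD : D.Nonempty) (hx : 0 < x) :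
    HasDerivAt (phi D) (((setGF (shiftSet D 1) x + x * setGF (shiftSet (shiftSet D 1) 1) x)
      * setGF D x - x * setGF (shiftSet D 1) x * setGF (shiftSet D 1) x) / setGF D x ^ 2) x := by
  have h := (((hasDerivAt_id x).mul (hasDerivAt_setGF (shiftSet D 1) x)).div (hasDerivAt_setGF D x)
    (setGF_pos hD hx).ne')
  simp only [id_eq, one_mul, Pi.mul_apply] at h
  exact h

/-- `x φ'(x)` is the variance of the Boltzmann distribution. -/
theorem hasSum_boltzmann_variance (hD : D.Nonempty) (hx : 0 < x) :
    HasSum (fun d => boltzmann D x d * ((d : ℝ) - phi D x) ^ 2) (x * deriv (phi D) x) := by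
  have hS := (setGF_pos hD hx).ne'
  have h2 := (hasSum_natCast_mul_pred_mul_setGF D x).div_const (setGF D x)
  have h1 := (hasSum_boltzmann_mul D x).mul_left (1 - 2 * phi D x)
  have h0 := (hasSum_boltzmann hD hx).mul_left (phi D x ^ 2)
  have e : x * deriv (phi D) x = x ^ 2 * setGF (shiftSet (shiftSet D 1) 1) x / setGF D x
      + (1 - 2 * phi D x) * phi D x + phi D x ^ 2 * 1 := by
    rw [(hasDerivAt_phi hD hx).deriv, phi]
    field_simp
    ring
  rw [e]
  refine HasSum.of_forall_eq ((h2.add h1).add h0) fun d => ?_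
  rw [boltzmann]
  ring

/-- Two atoms of mass at least `η` at distinct integers force a variance of at least `η / 2`. -/
theorem half_le_variance (hD : D.Nonempty) (hx : 0 < x) {d₁ d₂ : ℕ} (hne : d₁ ≠ d₂) {η : ℝ}
    (h₁ : η ≤ boltzmann D x d₁) (h₂ : η ≤ boltzmann D x d₂) (hη : 0 ≤ η) :
    η / 2 ≤ x * deriv (phi D) x := by
  have h := sum_le_hasSum {d₁, d₂}
    (fun d _ => mul_nonneg (boltzmann_nonneg hD hx d) (sq_nonneg _)) (hasSum_boltzmann_variance hD hx)
  rw [Finset.sum_pair hne] at h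
  refine le_trans ?_ h
  have hdiff : (1 : ℝ) ≤ ((d₁ : ℝ) - d₂) ^ 2 := by
    have h3 : (1 : ℤ) ≤ ((d₁ : ℤ) - d₂) ^ 2 := by
      have : (d₁ : ℤ) - d₂ ≠ 0 := by omega
      have := sq_pos_of_ne_zero this
      omega
    exact_mod_cast h3
  calc η / 2 ≤ η * (((d₁ : ℝ) - phi D x) ^ 2 + ((d₂ : ℝ) - phi D x) ^ 2) := by
        have : (1 : ℝ) / 2 ≤ ((d₁ : ℝ) - phi D x) ^ 2 + ((d₂ : ℝ) - phi D x) ^ 2 := by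
          nlinarith [sq_nonneg ((d₁ : ℝ) - phi D x + (d₂ - phi D x))]
        nlinarith
    _ ≤ _ := by
        rw [mul_add]
        gcongr

theorem boltzmann_pos {d : ℕ} (hd : d ∈ D) (hx : 0 < x) : 0 < boltzmann D x d := by
  have := setGF_pos ⟨d, hd⟩ hx
  rw [boltzmann, egfCoeff_of_mem hd]
  positivity

theorem deriv_phi_pos (hD : D.Nontrivial) (hx : 0 < x) : 0 < deriv (phi D) x := by
  obtain ⟨d₁, h₁, d₂, h₂, hne⟩ := hD
  have hpos := lt_min (boltzmann_pos h₁ hx) (boltzmann_pos h₂ hx)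
  have h := half_le_variance ⟨d₁, h₁⟩ hx hne (min_le_left _ _) (min_le_right _ _) hpos.le
  exact pos_of_mul_pos_right (lt_of_lt_of_le (half_pos hpos) h) hx.le

theorem strictMonoOn_phi (hD : D.Nontrivial) : StrictMonoOn (phi D) (Set.Ioi 0) := by
  refine strictMonoOn_of_deriv_pos (convex_Ioi 0) (fun y hy => ?_) fun y hy => ?_
  · exact (hasDerivAt_phi hD.nonempty hy).continuousAt.continuousWithinAt
  · rw [interior_Ioi] at hy
    exact deriv_phi_pos hD hy

/-- The moments of the Boltzmann distribution around `μ` are bounded by its exponential moment. -/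
theorem summable_and_abs_tsum_boltzmann_mul_pow_le (hD : D.Nonempty) (hx : 0 < x) {μ : ℝ}
    (hμ : 0 ≤ μ) (k : ℕ) :
    Summable (fun d => boltzmann D x d * ((d : ℝ) - μ) ^ k) ∧
      |∑' d, boltzmann D x d * ((d : ℝ) - μ) ^ k|
        ≤ k.factorial * (Real.exp μ * (setGF D (Real.exp 1 * x) / setGF D x)) := by
  have hle : ∀ d : ℕ, ‖boltzmann D x d * ((d : ℝ) - μ) ^ k‖
      ≤ k.factorial * (Real.exp μ * (egfCoeff D d * (Real.exp 1 * x) ^ d / setGF D x)) := by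
    intro d
    have h1 := Real.pow_div_factorial_le_exp (d + μ) (by positivity) k
    rw [div_le_iff₀ (by positivity)] at h1
    have h2 : |(d : ℝ) - μ| ≤ d + μ := by
      rw [abs_le]
      constructor <;> linarith [(Nat.cast_nonneg d : (0 : ℝ) ≤ d)]
    rw [Real.norm_eq_abs, abs_mul, abs_of_nonneg (boltzmann_nonneg hD hx d), abs_pow]
    calc _ ≤ boltzmann D x d * (Real.exp (d + μ) * k.factorial) := by
          refine mul_le_mul_of_nonneg_left ?_ (boltzmann_nonneg hD hx d)
          exact (pow_le_pow_left₀ (abs_nonneg _) h2 k).trans h1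
      _ = _ := by
          rw [boltzmann, Real.exp_add, mul_pow, ← Real.exp_nat_mul, mul_one]
          ring
  have hsum := (((hasSum_setGF D (Real.exp 1 * x)).div_const (setGF D x)).mul_left
    (Real.exp μ)).mul_left (k.factorial : ℝ)
  exact ⟨.of_norm_bounded hsum.summable hle, tsum_of_norm_bounded hsum hle⟩

end Boltzmann

/-- `φ` takes values below each `c > r`: near `0`, the term `d = r` dominates. -/
theorem exists_phi_lt {D : Set ℕ} (hD : D.Nonempty) {c : ℝ} (hc : (valuationOf D : ℝ) < c) :
    ∃ x, 0 < x ∧ phi D x < c := by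
  set r := valuationOf D with hr
  have hrD : r ∈ D := Nat.sInf_mem hD
  have hc0 : 0 ≤ c := (Nat.cast_nonneg r).trans hc.le
  have hE := hasSum_natCast_mul_setGF Set.univ 1
  simp only [egfCoeff_of_mem (Set.mem_univ _), one_pow, mul_one, one_mul] at hE
  set E := setGF (shiftSet Set.univ 1) 1 with hEdef
  have hE0 : 0 ≤ E := hE.nonneg fun d => by positivity
  -- for `x ≤ 1`, the numerator of `φ - c` is at most `x ^ r (E x - q)`
  set q := (c - r) / (r.factorial : ℝ) with hq
  have hq0 : 0 < q := div_pos (by linarith) (by positivity)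
  set x := q / (q + E + 1) with hx
  have hx0 : 0 < x := by positivity
  have hx1 : x ≤ 1 := by
    rw [hx, div_le_one (by positivity)]
    linarith
  refine ⟨x, hx0, ?_⟩
  have hSpos := setGF_pos hD hx0
  rw [phi, div_lt_iff₀ hSpos, ← sub_neg]
  have hF := (hasSum_natCast_mul_setGF D x).sub ((hasSum_setGF D x).mul_left c)
  have hG := (hE.mul_left (x ^ (r + 1))).add (hasSum_ite_eq r (-(q * x ^ r)))
  refine lt_of_le_of_lt (hasSum_le (fun d => ?_) hF hG) ?_
  · rcases lt_trichotomy d r with h | rfl | h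
    · rw [egfCoeff_of_notMem (Nat.notMem_of_lt_sInf h), if_neg h.ne]
      simp only [zero_mul, mul_zero, sub_zero, add_zero]
      positivity
    · rw [egfCoeff_of_mem hrD, if_pos rfl, hq]
      have : 0 ≤ x ^ (r + 1) * ((r : ℝ) * (1 / (r.factorial : ℝ))) := by positivity
      refine le_trans (le_of_eq ?_) (le_add_of_nonneg_left this)
      ring
    · rw [if_neg h.ne', add_zero]
      have h1 : x ^ d ≤ x ^ (r + 1) := pow_le_pow_of_le_one hx0.le hx1 h
      have h2 := egfCoeff_nonneg D d
      have h3 : 0 ≤ c * (egfCoeff D d * x ^ d) := by positivity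
      calc _ ≤ (d : ℝ) * (egfCoeff D d * x ^ d) := by linarith
        _ ≤ (d : ℝ) * (1 / (d.factorial : ℝ) * x ^ (r + 1)) := by
            gcongr
            exact egfCoeff_le D d
        _ = _ := by ring
  · have h1 : x * E < q := by
      rw [hx, div_mul_eq_mul_div, div_lt_iff₀ (by positivity)]
      nlinarith
    have h2 : (0 : ℝ) < x ^ r := by positivity
    rw [pow_succ]
    nlinarith

/-- `φ` takes values above each `c < max D`: near `∞`, an element `d > c` of `D` dominates those
below `c`. -/
theorem exists_lt_phi {D : Set ℕ} {c : ℝ} (hc0 : 0 ≤ c) {d₁ : ℕ} (hd₁ : d₁ ∈ D) (hc : c < d₁) :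
    ∃ x, 0 < x ∧ c < phi D x := by
  obtain ⟨k, rfl⟩ : ∃ k, d₁ = k + 1 := by
    refine ⟨d₁ - 1, ?_⟩
    have : (0 : ℝ) < d₁ := by linarith
    have : 0 < d₁ := by exact_mod_cast this
    omega
  have hE := hasSum_setGF Set.univ 1
  simp only [egfCoeff_of_mem (Set.mem_univ _), one_pow, mul_one] at hE
  set E := setGF Set.univ 1 with hEdef
  have hE0 : 0 ≤ E := hE.nonneg fun d => by positivity
  -- for `x ≥ 1`, the numerator of `φ - c` is at least `x ^ k (q x - c E)`
  set q := ((k + 1 : ℕ) - c) / ((k + 1).factorial : ℝ) with hq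
  have hq0 : 0 < q := div_pos (by linarith) (by positivity)
  set x := c * E / q + 1 with hx
  have hx1 : 1 ≤ x := by
    rw [hx]
    have : 0 ≤ c * E / q := by positivity
    linarith
  have hx0 : 0 < x := by linarith
  refine ⟨x, hx0, ?_⟩
  have hSpos := setGF_pos ⟨_, hd₁⟩ hx0
  rw [phi, lt_div_iff₀ hSpos, ← sub_pos]
  have hF := (hasSum_natCast_mul_setGF D x).sub ((hasSum_setGF D x).mul_left c)
  have hG := (hE.mul_left (-(c * x ^ k))).add (hasSum_ite_eq (k + 1) (q * x ^ (k + 1)))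
  refine lt_of_lt_of_le ?_ (hasSum_le (fun d => ?_) hG hF)
  · have h1 : c * E < q * x := by
      rw [hx, mul_add, mul_div_cancel₀ _ hq0.ne']
      linarith
    have h2 : (0 : ℝ) < x ^ k := by positivity
    rw [pow_succ]
    nlinarith
  · have h2 := egfCoeff_nonneg D d
    have h0 : 0 ≤ c * x ^ k * (1 / (d.factorial : ℝ)) := by positivity
    rcases lt_trichotomy d (k + 1) with h | rfl | h
    · rw [if_neg h.ne, add_zero]
      have h1 : x ^ d ≤ x ^ k := pow_le_pow_right₀ hx1 (Nat.lt_succ_iff.1 h)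
      have h3 : c * (egfCoeff D d * x ^ d) ≤ c * (1 / (d.factorial : ℝ) * x ^ k) := by
        gcongr
        exact egfCoeff_le D d
      have h4 : 0 ≤ (d : ℝ) * (egfCoeff D d * x ^ d) := by positivity
      linarith
    · rw [egfCoeff_of_mem hd₁, if_pos rfl, hq]
      have e : ((k + 1 : ℕ) : ℝ) * (1 / ((k + 1).factorial : ℝ) * x ^ (k + 1))
          - c * (1 / ((k + 1).factorial : ℝ) * x ^ (k + 1))
          = (((k + 1 : ℕ) : ℝ) - c) / ((k + 1).factorial : ℝ) * x ^ (k + 1) := by ring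
      rw [e]
      linarith
    · rw [if_neg h.ne', add_zero, ← sub_mul]
      have h3 : c ≤ d := hc.le.trans (by exact_mod_cast h.le)
      have h4 : 0 ≤ ((d : ℝ) - c) * (egfCoeff D d * x ^ d) :=
        mul_nonneg (by linarith) (by positivity)
      linarith

theorem existsUnique_phi_eq {D : Set ℕ} (hD : D.Nontrivial) {c : ℝ} (hc : (valuationOf D : ℝ) < c)
    (hc' : (c : EReal) < maxOf D) : ∃! ζ : ℝ, 0 < ζ ∧ phi D ζ = c := by
  obtain ⟨x, hx, hxc⟩ := exists_phi_lt hD.nonempty hc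
  simp only [maxOf, lt_iSup_iff, EReal.coe_lt_coe_iff] at hc'
  obtain ⟨d, hd, hcd⟩ := hc'
  obtain ⟨y, hy, hyc⟩ := exists_lt_phi ((Nat.cast_nonneg _).trans hc.le) hd hcd
  have hcont : ContinuousOn (phi D) (Set.Ioi 0) := fun z hz =>
    (hasDerivAt_phi hD.nonempty hz).continuousAt.continuousWithinAt
  obtain ⟨ζ, hζ, hζc⟩ := isPreconnected_Ioi.intermediate_value hx hy hcont ⟨hxc.le, hyc.le⟩
  exact ⟨ζ, ⟨hζ, hζc⟩, fun z hz => (strictMonoOn_phi hD).injOn hz.1 hζ (hz.2.trans hζc.symm)⟩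

/-! ### The saddle point estimate -/

theorem coeff_mk_boltzmann_pow (D : Set ℕ) (x : ℝ) (n N : ℕ) :
    PowerSeries.coeff N (PowerSeries.mk (boltzmann D x) ^ n)
      = PowerSeries.coeff N (PowerSeries.mk (egfCoeff D) ^ n) * (x ^ N / setGF D x ^ n) := by
  have h : PowerSeries.mk (boltzmann D x)
      = PowerSeries.C (setGF D x)⁻¹ * PowerSeries.rescale x (PowerSeries.mk (egfCoeff D)) := by
    ext d
    rw [PowerSeries.coeff_C_mul, PowerSeries.coeff_rescale, PowerSeries.coeff_mk,
      PowerSeries.coeff_mk, boltzmann]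
    ring
  rw [h, mul_pow, ← map_pow, ← map_pow, PowerSeries.coeff_C_mul, PowerSeries.coeff_rescale, inv_pow]
  ring

/-- On a compact interval of parameters, the Boltzmann weights of finitely many elements of `D`
are bounded below. -/
theorem exists_le_boltzmann {D : Set ℕ} {F : Finset ℕ} (hF : (F : Set ℕ) ⊆ D) (hne : F.Nonempty)
    {x₀ x₁ : ℝ} (hx₀ : 0 < x₀) :
    ∃ η : ℝ, 0 < η ∧ ∀ x ∈ Set.Icc x₀ x₁, ∀ d ∈ F, η ≤ boltzmann D x d := by
  rcases lt_or_ge x₁ x₀ with h | h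
  · exact ⟨1, one_pos, fun x hx => absurd (hx.1.trans hx.2) (not_le.2 h)⟩
  obtain ⟨e, he, hmin⟩ := F.exists_min_image (fun d => egfCoeff D d * x₀ ^ d / setGF D x₁) hne
  have hD : D.Nonempty := ⟨e, hF he⟩
  have hx₁ : 0 < x₁ := hx₀.trans_le h
  refine ⟨egfCoeff D e * x₀ ^ e / setGF D x₁, ?_, fun x hx d hd => (hmin d hd).trans ?_⟩
  · have := setGF_pos hD hx₁
    rw [egfCoeff_of_mem (hF he)]
    positivity
  · have hx0 : 0 < x := hx₀.trans_le hx.1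
    rw [boltzmann]
    have h1 := egfCoeff_nonneg D d
    have h2 := setGF_pos hD hx0
    have h3 := setGF_mono D hx0.le hx.2
    have h4 := hx.1
    gcongr

theorem sqrt_two_pi_div {y : ℝ} (hy : 0 < y) :
    √(2 * Real.pi / y) = 2 * Real.pi / √(2 * Real.pi * y) := by
  rw [eq_div_iff (by positivity), ← Real.sqrt_mul (by positivity),
    show 2 * Real.pi / y * (2 * Real.pi * y) = (2 * Real.pi) ^ 2 by field_simp,
    Real.sqrt_sq (by positivity)]

open Complex in
/-- Saddle point asymptotics of the coefficients of `Set_D ^ n`, uniform for the saddle point in a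
compact interval. It is the local limit theorem, with error term `O(1 / n)`, for the sum of `n`
independent Boltzmann variables at its mean. -/
theorem exists_coeff_pow_eq {D : Set ℕ} (hD : D.Nontrivial) {x₀ x₁ : ℝ} (hx₀ : 0 < x₀) :
    ∃ C : ℝ, ∀ ζ ∈ Set.Icc x₀ x₁, ∀ n N : ℕ, 2 ≤ n → (n : ℝ) * phi D ζ = N →
      (periodicity D : ℤ) ∣ (N : ℤ) - (valuationOf D : ℤ) * n →
      ∃ ε : ℝ, |ε| ≤ C / n ∧ PowerSeries.coeff N (PowerSeries.mk (egfCoeff D) ^ n)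
        = (periodicity D : ℝ) / √(2 * Real.pi * n * ζ * deriv (phi D) ζ)
          * (setGF D ζ ^ n / ζ ^ N) * (1 + ε) := by
  have hne := hD.nonempty
  rcases lt_or_ge x₁ x₀ with hlt | hle
  · exact ⟨0, fun x hx => absurd (hx.1.trans hx.2) (not_le.2 hlt)⟩
  have hx₁ : 0 < x₁ := hx₀.trans_le hle
  set r := valuationOf D with hr
  have hrD : r ∈ D := Nat.sInf_mem hne
  obtain ⟨hp, hdvd, -⟩ := periodicity_spec hD hrD
  obtain ⟨F, hF, κ, hκ, hdecay⟩ := exists_norm_charSum_le_exp hD hrD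
  set p := periodicity D with hpdef
  have hp' : (0 : ℝ) < p := by exact_mod_cast hp
  obtain ⟨d₁, hd₁, d₂, hd₂, hd₁₂⟩ := id hD
  have hF' : ((insert d₁ (insert d₂ F) : Finset ℕ) : Set ℕ) ⊆ D := by
    push_cast
    exact Set.insert_subset hd₁ (Set.insert_subset hd₂ hF)
  obtain ⟨η, hη, hwη⟩ := exists_le_boltzmann hF' (Finset.insert_nonempty _ _) (x₁ := x₁) hx₀
  -- `κ η²` is the decay rate of the characteristic function, `η / 2` a lower bound for the variance
  set c := min (κ * η ^ 2) (η / 4) with hc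
  have hc0 : 0 < c := by positivity
  -- `k! Q` bounds the `k`-th moment around the mean for all parameters; `96 = 4 * 4!` covers the
  -- Taylor remainder
  set Q := Real.exp (phi D x₁) * (setGF D (Real.exp 1 * x₁) / setGF D x₀) with hQ
  have hQ0 : 0 ≤ Q := by
    have := setGF_pos hne hx₀
    have := setGF_pos hne (mul_pos (Real.exp_pos 1) hx₁)
    positivity
  obtain ⟨C, -, hC⟩ := norm_integral_pow_sub_gaussian_le (c := c) (M := 96 * Q) (T := Real.pi / p)
    hc0 (by positivity) (by positivity)
  refine ⟨C, fun ζ hζ n N hn hmean hN => ?_⟩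
  have hζ0 : 0 < ζ := hx₀.trans_le hζ.1
  set w := boltzmann D ζ with hw
  set μ := phi D ζ with hμ
  set s := ζ * deriv (phi D) ζ with hs
  have hw0 : ∀ d, 0 ≤ w d := boltzmann_nonneg hne hζ0
  have hw1 : HasSum w 1 := hasSum_boltzmann hne hζ0
  have hmean1 : HasSum (fun d => w d * (d : ℝ)) μ := hasSum_boltzmann_mul D ζ
  have hμ0 : 0 ≤ μ := hmean1.nonneg fun d => mul_nonneg (hw0 d) (Nat.cast_nonneg d)
  have hμ1 : μ ≤ phi D x₁ := (strictMonoOn_phi hD).monotoneOn hζ0 hx₁ hζ.2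
  have hQle : Real.exp μ * (setGF D (Real.exp 1 * ζ) / setGF D ζ) ≤ Q := by
    have h1 := setGF_pos hne hx₀
    have h2 := setGF_mono D hx₀.le hζ.1
    have h3 := setGF_mono D (mul_pos (Real.exp_pos 1) hζ0).le
      (mul_le_mul_of_nonneg_left hζ.2 (Real.exp_pos 1).le)
    have h4 := setGF_pos hne (mul_pos (Real.exp_pos 1) hζ0)
    have h5 := setGF_pos hne (mul_pos (Real.exp_pos 1) hx₁)
    have h6 := setGF_pos hne hζ0
    rw [hQ]
    gcongr
  have hmom : ∀ k ≤ 4, HasSum (fun d => w d * ((d : ℝ) - μ) ^ k) (∑' d, w d * ((d : ℝ) - μ) ^ k) ∧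
      |∑' d, w d * ((d : ℝ) - μ) ^ k| ≤ 24 * Q := by
    intro k hk
    obtain ⟨h1, h2⟩ := summable_and_abs_tsum_boltzmann_mul_pow_le hne hζ0 hμ0 k
    refine ⟨h1.hasSum, h2.trans ?_⟩
    have : (k.factorial : ℝ) ≤ 24 := by exact_mod_cast Nat.factorial_le hk
    exact mul_le_mul this hQle (by
      have := setGF_pos hne hζ0
      have := setGF_pos hne (mul_pos (Real.exp_pos 1) hζ0)
      positivity) (by norm_num)
  have hvar : HasSum (fun d => w d * ((d : ℝ) - μ) ^ 2) s := hasSum_boltzmann_variance hne hζ0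
  have hcentre : HasSum (fun d => w d * ((d : ℝ) - μ)) 0 := by
    have := hmean1.sub (hw1.mul_right μ)
    rw [one_mul, sub_self] at this
    exact this.of_forall_eq fun d => by ring
  obtain ⟨h3, h3le⟩ := hmom 3 (by norm_num)
  obtain ⟨h4, h4le⟩ := hmom 4 le_rfl
  set m₃ := ∑' d, w d * ((d : ℝ) - μ) ^ 3 with hm₃
  set m₄ := ∑' d, w d * ((d : ℝ) - μ) ^ 4 with hm₄
  have hsc : 2 * c ≤ s := by
    have h1 := half_le_variance hne hζ0 hd₁₂ (hwη ζ hζ d₁ (by simp)) (hwη ζ hζ d₂ (by simp)) hη.le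
    have h2 : c ≤ η / 4 := min_le_right _ _
    linarith
  have hs0 : 0 < s := by linarith
  have hsM : s ≤ 96 * Q := by
    have h1 := (hmom 2 (by norm_num)).2
    rw [hvar.tsum_eq] at h1
    linarith [le_abs_self s]
  -- the centred characteristic function
  set g : ℝ → ℂ := fun t => (∑' d, (w d : ℂ) * cexp (I * t) ^ d) * cexp (-(I * μ * t)) with hg
  have hphase : ∀ t : ℝ, ‖cexp (-(I * μ * t))‖ = 1 := by
    intro t
    rw [show -(I * μ * t) = I * ((-(μ * t) : ℝ) : ℂ) by push_cast; ring]
    exact norm_exp_I_mul_ofReal _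
  have hgcont : Continuous g := by
    refine Continuous.mul ?_ (by fun_prop)
    refine continuous_tsum (fun d => by fun_prop) hw1.summable fun d t => ?_
    rw [norm_mul, norm_pow, norm_exp_I_mul_ofReal, one_pow, mul_one, norm_real,
      Real.norm_of_nonneg (hw0 d)]
  have hgdecay : ∀ t, |t| ≤ Real.pi / p → ‖g t‖ ≤ Real.exp (-c * t ^ 2) := by
    intro t ht
    rw [hg, norm_mul, hphase, mul_one]
    refine (hdecay w η hw0 hw1 hη.le (fun d hd => hwη ζ hζ d (by simp [hd])) t ht).trans ?_
    apply Real.exp_le_exp.2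
    have h1 : c ≤ κ * η ^ 2 := min_le_left _ _
    nlinarith [sq_nonneg t]
  have hgtaylor : ∀ t, |t| ≤ Real.pi / p →
      ‖g t - (1 - (s * t ^ 2 / 2 : ℝ) - I * (m₃ * t ^ 3 / 6 : ℝ))‖ ≤ 96 * Q * t ^ 4 := by
    intro t _
    have e : g t = ∑' d : ℕ, (w d : ℂ) * cexp (I * (((d : ℝ) - μ) * t : ℝ)) := by
      simp only [hg]
      rw [← tsum_mul_right]
      refine tsum_congr fun d => ?_
      rw [mul_assoc, ← Complex.exp_nat_mul, ← Complex.exp_add]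
      congr 2
      push_cast
      ring
    rw [e]
    refine (norm_charSum_sub_taylor_le hw0 hw1 hcentre hvar h3 h4 t).trans ?_
    have : 4 * m₄ ≤ 96 * Q := by linarith [le_abs_self m₄]
    exact mul_le_mul_of_nonneg_right this (by positivity)
  have key := hC s m₃ g hgcont hsc hsM (h3le.trans (by linarith)) hgdecay hgtaylor n hn
  have hn0 : (0 : ℝ) < n := by exact_mod_cast (by omega : 0 < n)
  set q := PowerSeries.coeff N (PowerSeries.mk w ^ n) with hq
  have hint : ∫ t in (-(Real.pi / p))..(Real.pi / p), g t ^ n = ((2 * Real.pi / p * q : ℝ) : ℂ) := by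
    rw [hq, ← integral_charSum_pow hw0 hw1.summable hp (r := r) (fun d hd => ?_) n N hN]
    · refine intervalIntegral.integral_congr fun t _ => ?_
      simp only [hg]
      rw [mul_pow, ← Complex.exp_nat_mul]
      congr 2
      rw [← Complex.ofReal_natCast N, ← hmean]
      push_cast
      ring
    · refine hdvd d ?_
      by_contra h
      exact hd (by rw [hw, boltzmann, egfCoeff_of_notMem h, zero_mul, zero_div])
  rw [hint, ← ofReal_sub, norm_real, Real.norm_eq_abs] at key
  set G := √(2 * Real.pi / (n * s)) with hG
  have hG0 : 0 < G := by positivity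
  refine ⟨2 * Real.pi / p * q / G - 1, ?_, ?_⟩
  · rw [div_sub_one hG0.ne', abs_div, abs_of_pos hG0, div_le_iff₀ hG0]
    exact key
  · have hGeq : G = 2 * Real.pi / √(2 * Real.pi * n * ζ * deriv (phi D) ζ) := by
      rw [hG, sqrt_two_pi_div (by positivity), hs]
      congr 2
      ring
    have hR : 0 < √(2 * Real.pi * n * ζ * deriv (phi D) ζ) := by
      have := deriv_phi_pos hD hζ0
      positivity
    have hqeq := coeff_mk_boltzmann_pow D ζ n N
    rw [← hw, ← hq] at hqeq
    have hS := setGF_pos hne hζ0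
    rw [hGeq, hqeq]
    field_simp
    ring

theorem theorem3 (D : Set ℕ) (hD : D.Nontrivial) (a b : ℝ)
    (ha : (valuationOf D : ℝ) < a) (hb : (b : EReal) < maxOf D) :
    (∀ m n : ℕ, 0 < n → 2 * (m : ℝ) / (n : ℝ) ∈ Set.Icc a b →
      ∃! ζ : ℝ, 0 < ζ ∧ phi D ζ = 2 * (m : ℝ) / (n : ℝ)) ∧
    ∃ (C : ℝ) (N : ℕ), ∀ m n : ℕ, N ≤ n → 0 < n →
      2 * (m : ℝ) / (n : ℝ) ∈ Set.Icc a b →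
      (periodicity D : ℤ) ∣ 2 * (m : ℤ) - (valuationOf D : ℤ) * (n : ℤ) →
      ∀ ζ : ℝ, 0 < ζ → phi D ζ = 2 * (m : ℝ) / (n : ℝ) →
        DifferentiableAt ℝ (phi D) ζ ∧ 0 < deriv (phi D) ζ ∧
        ∃ ε : ℝ, |ε| ≤ C / (n : ℝ) ∧
          totalWeight D n m =
            (Nat.factorial (2 * m) : ℝ) / (2 ^ m * (Nat.factorial m : ℝ)) *
              ((periodicity D : ℝ) / Real.sqrt (2 * Real.pi * (n : ℝ) * ζ * deriv (phi D) ζ)) *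
              (setGF D ζ ^ n / ζ ^ (2 * m)) * (1 + ε) := by
  have hmax : ∀ {c : ℝ}, c ≤ b → (c : EReal) < maxOf D := fun hc =>
    lt_of_le_of_lt (EReal.coe_le_coe_iff.2 hc) hb
  refine ⟨fun m n _ hmn => existsUnique_phi_eq hD (ha.trans_le hmn.1) (hmax hmn.2), ?_⟩
  rcases lt_or_ge b a with hba | hab
  · exact ⟨0, 0, fun m n _ _ hmn => absurd (hmn.1.trans hmn.2) (not_le.2 hba)⟩
  obtain ⟨x₀, ⟨hx₀, hx₀a⟩, -⟩ := existsUnique_phi_eq hD ha (hmax hab)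
  obtain ⟨x₁, ⟨hx₁, hx₁b⟩, -⟩ := existsUnique_phi_eq hD (ha.trans_le hab) hb
  obtain ⟨C, hC⟩ := exists_coeff_pow_eq hD (x₁ := x₁) hx₀
  refine ⟨C, 2, fun m n hn hn0 hmn hdvd ζ hζ hφ => ?_⟩
  refine ⟨(hasDerivAt_phi hD.nonempty hζ).differentiableAt, deriv_phi_pos hD hζ, ?_⟩
  have hmono := strictMonoOn_phi hD
  have hζI : ζ ∈ Set.Icc x₀ x₁ := by
    constructor
    · rw [← hmono.le_iff_le hx₀ hζ, hx₀a, hφ]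
      exact hmn.1
    · rw [← hmono.le_iff_le hζ hx₁, hx₁b, hφ]
      exact hmn.2
  have hmean : (n : ℝ) * phi D ζ = (2 * m : ℕ) := by
    have : (n : ℝ) ≠ 0 := by positivity
    rw [hφ]
    push_cast
    field_simp
  obtain ⟨ε, hε, heq⟩ := hC ζ hζI n (2 * m) hn hmean (by exact_mod_cast hdvd)
  refine ⟨ε, hε, ?_⟩
  rw [totalWeight_eq_coeff, heq]
  ring
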